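/- Let $0<a\le\infty$ and let $f$ be complex analytic in $[0,a]$ (in $[0,\infty)$ if $a=\infty$), i.e. $f$ is a function of a complex variable that is analytic in a neighbourhood of each point of this interval. Let $\rho_0\in(0,\infty]$ be the distance from the origin to the nearest singularity of $f$ ($\rho_0=\infty$ if $f$ is entire). Let $0<\omega<\min(a,\rho_0)$. Notation. For finite $a$, $\operatorname{PV}\!\int_0^a h(x)\,dx=\lim_{\varepsilon\to0^+}\bigl(\int_0^{\omega-\varepsilon}h+\int_{\omega+\varepsilon}^a h\bigr)$. The finite part $\operatorname{f.p.}\!\int_0^a h(x)\,dx$ is $\lim_{\varepsilon\to0^+}C_\varepsilon$, where $\int_\varepsilon^a h(x)\,dx=C_\varepsilon+D_\varepsilon$, $C_\varepsilon$ converges, and $D_\varepsilon$ is a finite linear combination of $\ln\varepsilon$ and of powers $\varepsilon^{-p}$ with $p>0$. For $a=\infty$, principal values, finite parts and integrals over $(0,\infty)$ are the limits for $b\to\infty$ of those over $(0,b)$. If $a=\infty$, assume in addition that $\operatorname{PV}\!\int_0^\infty \frac{\omega f(x)}{\omega^2-x^2}\,dx$ exists, or that $f(x)x^{-2}$ is integrable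 at infinity (i.e. $\int_1^b f(x)x^{-2}\,dx$ converges as $b\to\infty$). Then all the principal values, finite parts, integrals and series below exist or converge, and: 1. $$\operatorname{PV}\!\int_0^a\frac{\omega f(x)}{\omega^2-x^2}\,dx=-\sum_{k=0}^\infty\omega^{2k+1}\operatorname{f.p.}\!\int_0^a\frac{f(x)}{x^{2k+2}}\,dx+\frac12\,[f(\omega)-f(-\omega)]\ln\omega .$$ 2. If $f$ is even (it suffices that $f(-x)=f(x)$ for real $|x|<\rho_0$), then $$\operatorname{PV}\!\int_0^a\frac{\omega f(x)}{\omega^2-x^2}\,dx=-\sum_{k=0}^\infty\omega^{2k+1}\operatorname{f.p.}\!\int_0^a\frac{f(x)}{x^{2k+2}}\,dx .$$ 3. If $f(z)=z^m g(z)$ with $m$ a positive integer and $g$ analytic at $0$, then $$\operatorname{PV}\!\int_0^a\frac{\omega f(x)}{\omega^2-x^2}\,dx=-\sum_{k=0}^{\lfloor (m-2)/2\rfloor}\omega^{2k+1}\int_0^a x^{m-2k-2}g(x)\,dx-\sum_{k=0}^\infty\omega^{2k+2\lfloor m/2\rfloor+1}\operatorname{f.p.}\!\int_0^a\frac{x^m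 g(x)}{x^{2k+2\lfloor m/2\rfloor+2}}\,dx+\frac{\omega^m}{2}\,[g(\omega)-(-1)^m g(-\omega)]\ln\omega ,$$ where the first sum is empty for $m=1$. The last term vanishes when $g$ is even and $m$ is even. -/

import Mathlib

open Filter Topology MeasureTheory

/-- A notion `Q b L` (read: "the integral from `0` to `b` has the value `L`") for finite upper limits
`b`, extended to the upper limit `∞` as the limit of its values when `b → ∞`. -/
def UpTo (Q : ℝ → ℂ → Prop) : WithTop ℝ → ℂ → Prop
  | (b : ℝ), L => Q b L
  | ⊤, L => ∃ P : ℝ → ℂ, (∀ᶠ b in atTop, Q b (P b)) ∧ Tendsto P atTop (𝓝 L)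

/-- The ordinary integral `∫₀ᵃ h(x) dx` exists and equals `L`
(for `a = ∞`: as an improper integral at infinity). -/
def HasIntegralUpTo (h : ℝ → ℂ) : WithTop ℝ → ℂ → Prop :=
  UpTo fun b L => IntervalIntegrable h volume 0 b ∧ ∫ x in (0 : ℝ)..b, h x = L

/-- The Cauchy principal value `PV ∫₀ᵃ h(x) dx` with respect to the singular point `c ∈ (0, a)`
exists and equals `L`; for `a = ∞` it is the limit of the principal values over `(0, b)`
as `b → ∞`. -/
def HasPVIntegral (h : ℝ → ℂ) (c : ℝ) : WithTop ℝ → ℂ → Prop :=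
  UpTo fun b L =>
    (∀ᶠ ε in 𝓝[>] (0 : ℝ), IntervalIntegrable h volume 0 (c - ε) ∧
      IntervalIntegrable h volume (c + ε) b) ∧
    Tendsto (fun ε : ℝ => (∫ x in (0 : ℝ)..(c - ε), h x) + ∫ x in (c + ε)..b, h x)
      (𝓝[>] 0) (𝓝 L)

/-- `D` is a diverging part: a finite linear combination of diverging powers `ε ^ (-p)`, `p > 0`,
and of `ln ε`. -/
def IsDivergingPart (D : ℝ → ℂ) : Prop :=
  ∃ (s : Finset ℝ) (c : ℝ → ℂ) (b : ℂ), (∀ p ∈ s, 0 < p) ∧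
    ∀ ε : ℝ, D ε = ∑ p ∈ s, c p * ((ε ^ (-p) : ℝ) : ℂ) + b * (Real.log ε : ℂ)

/-- The finite part of the (in general divergent) integral `∫₀ᵃ h(x) dx`, with the singularity at
`0`, exists and equals `L`: `∫_ε^a h(x) dx = C_ε + D_ε` with `D_ε` a diverging part and `C_ε → L`
as `ε → 0+`.  For `a = ∞` it is the limit of the finite parts over `(0, b)` as `b → ∞`. -/
def HasFinitePart (h : ℝ → ℂ) : WithTop ℝ → ℂ → Prop :=
  UpTo fun b L =>
    (∀ᶠ ε in 𝓝[>] (0 : ℝ), IntervalIntegrable h volume ε b) ∧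
    ∃ D : ℝ → ℂ, IsDivergingPart D ∧
      Tendsto (fun ε : ℝ => (∫ x in ε..b, h x) - D ε) (𝓝[>] 0) (𝓝 L)

/-- A diverging part that converges has limit `0`. -/
theorem IsDivergingPart.eq_zero_of_tendsto {D : ℝ → ℂ} (hD : IsDivergingPart D) {L : ℂ}
    (h : Tendsto D (𝓝[>] 0) (𝓝 L)) : L = 0 := by
  obtain ⟨s, c, b, hs, hD⟩ := hD
  have hrpow : ∀ r : ℝ, 0 < r → Tendsto (fun ε : ℝ => ((ε ^ r : ℝ) : ℂ)) (𝓝[>] 0) (𝓝 0) := by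
    intro r hr
    have h1 : Tendsto (fun ε : ℝ => ε ^ r) (𝓝[>] 0) (𝓝 0) := by
      have := (Real.continuousAt_rpow_const 0 r (Or.inr hr.le)).tendsto
      rw [Real.zero_rpow hr.ne'] at this
      exact this.mono_left nhdsWithin_le_nhds
    have := (Complex.continuous_ofReal.tendsto 0).comp h1
    simpa [Function.comp_def] using this
  induction s using Finset.induction_on_max generalizing D with
  | empty =>
    have h1 : Tendsto (fun ε : ℝ => ((Real.log ε : ℂ))⁻¹) (𝓝[>] 0) (𝓝 0) := by
      have h2 : Tendsto (fun ε : ℝ => (Real.log ε)⁻¹) (𝓝[>] 0) (𝓝 0) :=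
        tendsto_inv_atBot_zero.comp Real.tendsto_log_nhdsGT_zero
      have := (Complex.continuous_ofReal.tendsto 0).comp h2
      simpa [Function.comp_def] using this
    have h3 := h.mul h1
    have hev : ∀ᶠ ε : ℝ in 𝓝[>] 0, D ε * ((Real.log ε : ℂ))⁻¹ = b := by
      filter_upwards [Real.tendsto_log_nhdsGT_zero.eventually_lt_atBot 0] with ε hε
      have : (Real.log ε : ℂ) ≠ 0 := by exact_mod_cast hε.ne
      rw [hD]
      simp only [Finset.sum_empty, zero_add]
      field_simp
    have hb : b = 0 := by
      have h4 := tendsto_nhds_unique (h3.congr' hev) tendsto_const_nhds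
      simpa using h4.symm
    have hz : D = fun _ => 0 := by
      funext ε
      simp [hD, hb]
    rw [hz] at h
    exact tendsto_nhds_unique h tendsto_const_nhds
  | insert p s hlt ih =>
    have hp : 0 < p := hs p (Finset.mem_insert_self _ _)
    have hps : p ∉ s := fun hm => lt_irrefl _ (hlt p hm)
    have h1 := (hrpow p hp).mul h
    have hlog : Tendsto (fun ε : ℝ => ((Real.log ε * ε ^ p : ℝ) : ℂ)) (𝓝[>] 0) (𝓝 0) := by
      have := (Complex.continuous_ofReal.tendsto 0).comp (tendsto_log_mul_rpow_nhdsGT_zero hp)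
      simpa only [Complex.ofReal_zero, Function.comp_def] using this
    have h2 : Tendsto (fun ε : ℝ => c p + ∑ q ∈ s, c q * ((ε ^ (p - q) : ℝ) : ℂ)
        + b * ((Real.log ε * ε ^ p : ℝ) : ℂ)) (𝓝[>] 0)
        (𝓝 (c p + ∑ q ∈ s, c q * 0 + b * 0)) :=
      (tendsto_const_nhds.add (tendsto_finsetSum _ fun q hq =>
        (hrpow (p - q) (sub_pos.2 (hlt q hq))).const_mul (c q))).add (hlog.const_mul b)
    have hcp : c p = 0 := by
      have hev : ∀ᶠ ε : ℝ in 𝓝[>] 0, ((ε ^ p : ℝ) : ℂ) * D ε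
          = c p + ∑ q ∈ s, c q * ((ε ^ (p - q) : ℝ) : ℂ)
            + b * ((Real.log ε * ε ^ p : ℝ) : ℂ) := by
        filter_upwards [self_mem_nhdsWithin] with ε hε
        have hε : 0 < ε := hε
        have hmul : ∀ q : ℝ, ((ε ^ p : ℝ) : ℂ) * ((ε ^ (-q) : ℝ) : ℂ) = ((ε ^ (p - q) : ℝ) : ℂ) := by
          intro q
          rw [← Complex.ofReal_mul, ← Real.rpow_add hε, sub_eq_add_neg]
        rw [hD, Finset.sum_insert hps, mul_add, mul_add, Finset.mul_sum]
        refine congrArg₂ (· + ·) (congrArg₂ (· + ·) ?_ ?_) ?_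
        · rw [mul_left_comm, hmul, sub_self, Real.rpow_zero]; simp
        · refine Finset.sum_congr rfl fun q _ => ?_
          rw [mul_left_comm, hmul]
        · push_cast; ring
      have h3 := tendsto_nhds_unique (h1.congr' hev) h2
      simpa using h3.symm
    refine ih h (fun q hq => hs q (Finset.mem_insert_of_mem hq)) fun ε => ?_
    rw [hD, Finset.sum_insert hps, hcp]
    simp

theorem IsDivergingPart.sub {D E : ℝ → ℂ} (hD : IsDivergingPart D) (hE : IsDivergingPart E) :
    IsDivergingPart (D - E) := by
  classical
  obtain ⟨s, c, b, hs, hD⟩ := hD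
  obtain ⟨t, d, e, ht, hE⟩ := hE
  refine ⟨s ∪ t, fun p => (if p ∈ s then c p else 0) - (if p ∈ t then d p else 0), b - e,
    fun p hp => (Finset.mem_union.1 hp).elim (hs p) (ht p), fun ε => ?_⟩
  have h1 : ∑ p ∈ s ∪ t, (if p ∈ s then c p else 0) * ((ε ^ (-p) : ℝ) : ℂ)
      = ∑ p ∈ s, c p * ((ε ^ (-p) : ℝ) : ℂ) := by
    rw [← Finset.sum_subset Finset.subset_union_left]
    · exact Finset.sum_congr rfl fun p hp => by simp [hp]
    · intro p _ hp; simp [hp]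
  have h2 : ∑ p ∈ s ∪ t, (if p ∈ t then d p else 0) * ((ε ^ (-p) : ℝ) : ℂ)
      = ∑ p ∈ t, d p * ((ε ^ (-p) : ℝ) : ℂ) := by
    rw [← Finset.sum_subset Finset.subset_union_right]
    · exact Finset.sum_congr rfl fun p hp => by simp [hp]
    · intro p _ hp; simp [hp]
  simp only [Pi.sub_apply, hD, hE, sub_mul, Finset.sum_sub_distrib, h1, h2]
  ring

/-- The finite part is well defined: its value is unique. -/
theorem HasFinitePart.unique {h : ℝ → ℂ} {a : WithTop ℝ} {L M : ℂ}
    (hL : HasFinitePart h a L) (hM : HasFinitePart h a M) : L = M := by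
  have key : ∀ (b : ℝ) (L M : ℂ), HasFinitePart h b L → HasFinitePart h b M → L = M := by
    rintro b L M ⟨-, D, hD, hL⟩ ⟨-, E, hE, hM⟩
    have h1 : Tendsto (E - D) (𝓝[>] 0) (𝓝 (L - M)) := by
      refine (hL.sub hM).congr fun ε => ?_
      simp only [Pi.sub_apply]
      ring
    exact sub_eq_zero.1 ((hE.sub hD).eq_zero_of_tendsto h1)
  cases a with
  | coe b => exact key b L M hL hM
  | top =>
    obtain ⟨P, hP, hPL⟩ := hL
    obtain ⟨R, hR, hRM⟩ := hM
    refine tendsto_nhds_unique hPL (hRM.congr' ?_)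
    filter_upwards [hP, hR] with b h1 h2
    exact key b _ _ h2 h1

/-- `f` is complex analytic in the real interval `[0, a]` (in `[0, ∞)` if `a = ∞`): it is
holomorphic in a neighbourhood of each point of the interval. -/
def ComplexAnalyticUpTo (f : ℂ → ℂ) (a : WithTop ℝ) : Prop :=
  ∀ x : ℝ, 0 ≤ x → (x : WithTop ℝ) ≤ a → AnalyticAt ℂ f (x : ℂ)

/-- The distance `ρ₀` from the origin to the nearest singularity of `f`; it is `∞` if `f` is
entire. -/
noncomputable def singularityDist (f : ℂ → ℂ) : ENNReal :=
  Metric.infEDist (0 : ℂ) {z : ℂ | ¬ AnalyticAt ℂ f z}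

/-- `f` is even on the real points of the disc `|z| < ρ`. -/
def EvenWithin (f : ℂ → ℂ) (ρ : ENNReal) : Prop :=
  ∀ x : ℝ, ENNReal.ofReal |x| < ρ → f (-(x : ℂ)) = f (x : ℂ)

/-- `h` is integrable at infinity, in the sense of improper integrals:
`∫₁ᵇ h(x) dx` converges as `b → ∞`. -/
def ImproperIntegrableAtInfty (h : ℝ → ℂ) : Prop :=
  ∃ L : ℂ, Tendsto (fun b : ℝ => ∫ x in (1 : ℝ)..b, h x) atTop (𝓝 L)

/-! ### Calculus of finite parts over a finite interval -/

/-! On a finite interval `(0, b)` both sides of the formula are linear in `f`. Two divided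
differences, at `ω` and then at `-ω`, give `f(x) = α + βx - (ω² - x²) q(x)` with `q` as regular as
`f` and `β = (f(ω) - f(-ω)) / (2ω)`, so three kinds of function suffice.

For `1` and `x` everything is explicit: the principal value comes from a logarithmic antiderivative
and the series is a Taylor series of a logarithm. Only `x` produces an extra term, `ω ln ω`;
multiplied by `β` it is the logarithmic term of the theorem (`HasPVExpansion.one`,
`HasPVExpansion.id`).

For `(ω² - x²) h` the kernel cancels and the principal value is `ω ∫ h`. If `H n` is the finite part
of `h / x ^ n`, the `k`-th term of the series is `ω^(2k+3) H(2k+2) - ω^(2k+1) H(2k)`, so the series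
telescopes to `-ω H 0 = -ω ∫ h`, provided that `ω^(2k+1) H(2k) → 0`. This holds because `H n =
O(R^(-n))` for some `R > ω` inside the disc of holomorphy (`exists_hasFinitePart_div_pow_bound`).

On `(0, ∞)`, integration by parts in the manner of Abel's test shows that convergence of `∫ f / x²`
implies that of all `∫ f / x^(2k+2)`, with tails beyond `R` bounded by `M / R^(2k)` uniformly in the
upper limit (`exists_tendsto_integral_div_pow`). Dominated convergence then lets `b → ∞` inside the
series. The same test derives the convergence of `∫ f / x²` from the existence of the principal
value.

When `f = x^m g`, the first `⌊m/2⌋` finite parts are ordinary integrals, and the third formula is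
the first one with these terms split off. -/

theorem IsDivergingPart.zero : IsDivergingPart 0 :=
  ⟨∅, 0, 0, by simp, fun ε => by simp⟩

theorem IsDivergingPart.add {D E : ℝ → ℂ} (hD : IsDivergingPart D) (hE : IsDivergingPart E) :
    IsDivergingPart (D + E) := by
  have := hD.sub (IsDivergingPart.zero.sub hE)
  simpa using this

theorem IsDivergingPart.const_mul {D : ℝ → ℂ} (hD : IsDivergingPart D) (z : ℂ) :
    IsDivergingPart (fun ε => z * D ε) := by
  obtain ⟨s, c, b, hs, hD⟩ := hD
  refine ⟨s, fun p => z * c p, z * b, hs, fun ε => ?_⟩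
  beta_reduce
  rw [hD, mul_add, Finset.mul_sum, mul_assoc]
  simp only [mul_assoc]

namespace HasFinitePart

variable {h g : ℝ → ℂ} {b R : ℝ} {L M : ℂ}

theorem congr (hb : 0 < b) (hL : HasFinitePart h b L) (hhg : ∀ x, 0 < x → x ≤ b → h x = g x) :
    HasFinitePart g b L := by
  obtain ⟨hi, D, hD, hL⟩ := hL
  have hpos : ∀ᶠ ε : ℝ in 𝓝[>] 0, ε ∈ Set.Ioo 0 b := Ioo_mem_nhdsGT hb
  have heq : ∀ ε ∈ Set.Ioo 0 b, ∀ x ∈ Set.uIcc ε b, h x = g x := fun ε hε x hx => by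
    rw [Set.uIcc_of_le hε.2.le] at hx
    exact hhg x (hε.1.trans_le hx.1) hx.2
  refine ⟨?_, D, hD, hL.congr' ?_⟩
  · filter_upwards [hi, hpos] with ε h1 hε
    exact h1.congr fun x hx => heq ε hε x (Set.uIoc_subset_uIcc hx)
  · filter_upwards [hpos] with ε hε
    rw [intervalIntegral.integral_congr (heq ε hε)]

theorem add (hL : HasFinitePart h b L) (hM : HasFinitePart g b M) :
    HasFinitePart (fun x => h x + g x) b (L + M) := by
  obtain ⟨hi, D, hD, hL⟩ := hL
  obtain ⟨gi, E, hE, hM⟩ := hM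
  refine ⟨?_, D + E, hD.add hE, (hL.add hM).congr' ?_⟩
  · filter_upwards [hi, gi] with ε h1 h2 using h1.add h2
  · filter_upwards [hi, gi] with ε h1 h2
    rw [intervalIntegral.integral_add h1 h2, Pi.add_apply]
    ring

theorem const_mul (hL : HasFinitePart h b L) (z : ℂ) :
    HasFinitePart (fun x => z * h x) b (z * L) := by
  obtain ⟨hi, D, hD, hL⟩ := hL
  refine ⟨?_, _, hD.const_mul z, (hL.const_mul z).congr fun ε => ?_⟩
  · filter_upwards [hi] with ε h1 using h1.const_mul z
  · rw [intervalIntegral.integral_const_mul]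
    ring

theorem sum {ι : Type*} {s : Finset ι} {h : ι → ℝ → ℂ} {L : ι → ℂ}
    (hL : ∀ i ∈ s, HasFinitePart (h i) b (L i)) :
    HasFinitePart (fun x => ∑ i ∈ s, h i x) b (∑ i ∈ s, L i) := by
  classical
  induction s using Finset.induction_on with
  | empty =>
    refine ⟨by simp, 0, IsDivergingPart.zero, ?_⟩
    simp
  | insert i s his ih =>
    simp only [Finset.sum_insert his]
    exact (hL i (Finset.mem_insert_self _ _)).add
      (ih fun j hj => hL j (Finset.mem_insert_of_mem hj))

theorem of_intervalIntegrable (hb : 0 < b) (hh : IntervalIntegrable h volume 0 b) :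
    HasFinitePart h b (∫ x in (0 : ℝ)..b, h x) := by
  have hev : ∀ᶠ ε : ℝ in 𝓝[>] 0, ε ∈ Set.Ioo 0 b := Ioo_mem_nhdsGT hb
  have hint : ∀ ε ∈ Set.Ioo 0 b, IntervalIntegrable h volume 0 ε ∧
      IntervalIntegrable h volume ε b := fun ε hε => by
    have h0 : (0 : ℝ) ∈ Set.uIcc 0 b := Set.left_mem_uIcc
    have h1 : ε ∈ Set.uIcc 0 b := by rw [Set.uIcc_of_le hb.le]; exact ⟨hε.1.le, hε.2.le⟩
    exact ⟨hh.mono_set (Set.uIcc_subset_uIcc h0 h1),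
      hh.mono_set (Set.uIcc_subset_uIcc h1 Set.right_mem_uIcc)⟩
  refine ⟨hev.mono fun ε hε => (hint ε hε).2, 0, IsDivergingPart.zero, ?_⟩
  have hc := intervalIntegral.continuousOn_primitive_interval' hh
    (Set.left_mem_uIcc : (0 : ℝ) ∈ Set.uIcc 0 b) 0 Set.left_mem_uIcc
  have hc' : Tendsto (fun ε => ∫ x in (0 : ℝ)..ε, h x) (𝓝[>] 0) (𝓝 0) := by
    have h2 : 𝓝[>] (0 : ℝ) ≤ 𝓝[Set.uIcc 0 b] 0 := by
      rw [Set.uIcc_of_le hb.le, ← nhdsWithin_Ioo_eq_nhdsGT hb]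
      exact nhdsWithin_mono _ Set.Ioo_subset_Icc_self
    have := hc.tendsto.mono_left h2
    simpa using this
  have := (tendsto_const_nhds (x := ∫ x in (0 : ℝ)..b, h x)).sub hc'
  rw [sub_zero] at this
  refine this.congr' (hev.mono fun ε hε => ?_)
  rw [← intervalIntegral.integral_add_adjacent_intervals (hint ε hε).1 (hint ε hε).2]
  simp

/-- The divergence sits at `0` alone, so the same diverging part serves every upper limit. This
separates the power series region `(0, R)` from the rest. -/
theorem add_integral (hL : HasFinitePart h R L) (hh : IntervalIntegrable h volume R b) :
    HasFinitePart h b (L + ∫ x in R..b, h x) := by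
  obtain ⟨hi, D, hD, hL⟩ := hL
  refine ⟨hi.mono fun ε h1 => h1.trans hh, D, hD, (hL.add_const _).congr' ?_⟩
  filter_upwards [hi] with ε h1
  rw [← intervalIntegral.integral_add_adjacent_intervals h1 hh]
  ring

/-- The one power whose finite part is not homogeneous in `b`; this is the origin of the `ln ω` in
the theorem. -/
theorem inv (hb : 0 < b) : HasFinitePart (fun x : ℝ => (x : ℂ)⁻¹) b (Real.log b : ℂ) := by
  have hpos : ∀ᶠ ε : ℝ in 𝓝[>] 0, 0 < ε := self_mem_nhdsWithin
  refine ⟨?_, fun ε => -(Real.log ε : ℂ), ⟨∅, 0, -1, by simp, fun ε => by simp⟩, ?_⟩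
  · filter_upwards [hpos] with ε hε
    refine ContinuousOn.intervalIntegrable fun x hx => ?_
    have : (x : ℂ) ≠ 0 := by
      exact_mod_cast (lt_of_lt_of_le (lt_min hε hb) hx.1).ne'
    exact (Complex.continuous_ofReal.continuousAt.inv₀ this).continuousWithinAt
  · refine tendsto_const_nhds.congr' ?_
    filter_upwards [hpos] with ε hε
    have : ∫ x in ε..b, (x : ℂ)⁻¹ = ((∫ x in ε..b, x⁻¹ : ℝ) : ℂ) := by
      rw [← intervalIntegral.integral_ofReal]
      simp
    rw [this, integral_inv_of_pos hε hb, Real.log_div hb.ne' hε.ne']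
    push_cast
    ring

theorem inv_pow (hb : 0 < b) (n : ℕ) :
    HasFinitePart (fun x : ℝ => ((x : ℂ) ^ (n + 2))⁻¹) b
      (-(((n : ℂ) + 1) * (b : ℂ) ^ (n + 1))⁻¹) := by
  have hpos : ∀ᶠ ε : ℝ in 𝓝[>] 0, 0 < ε := self_mem_nhdsWithin
  have hn : (n : ℂ) + 1 ≠ 0 := by exact_mod_cast n.succ_ne_zero
  refine ⟨?_, fun ε => ((n : ℂ) + 1)⁻¹ * ((ε ^ (-((n : ℝ) + 1)) : ℝ) : ℂ),
    ⟨{(n : ℝ) + 1}, fun _ => ((n : ℂ) + 1)⁻¹, 0, ?_, fun ε => by simp⟩, ?_⟩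
  · filter_upwards [hpos] with ε hε
    refine ContinuousOn.intervalIntegrable fun x hx => ?_
    have : (x : ℂ) ^ (n + 2) ≠ 0 := pow_ne_zero _ (by
      exact_mod_cast (lt_of_lt_of_le (lt_min hε hb) hx.1).ne')
    exact ((Complex.continuous_ofReal.pow (n + 2)).continuousAt.inv₀ this).continuousWithinAt
  · intro p hp
    rw [Finset.mem_singleton.1 hp]
    positivity
  · refine tendsto_const_nhds.congr' ?_
    filter_upwards [hpos] with ε hε
    have h0 : (0 : ℝ) ∉ Set.uIcc ε b := fun h => (lt_min hε hb).not_ge h.1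
    have h1 : ∫ x in ε..b, ((x : ℂ) ^ (n + 2))⁻¹
        = ((∫ x in ε..b, x ^ (-((n : ℤ) + 2)) : ℝ) : ℂ) := by
      rw [← intervalIntegral.integral_ofReal]
      refine intervalIntegral.integral_congr fun x _ => ?_
      have : x ^ (-((n : ℤ) + 2)) = (x ^ (n + 2))⁻¹ := by
        rw [zpow_neg]; norm_cast
      simp only [this]
      push_cast
      rfl
    have h2 : ∀ y : ℝ, y ^ (-((n : ℤ) + 2) + 1) = (y ^ (n + 1))⁻¹ := fun y => by
      rw [show -((n : ℤ) + 2) + 1 = -((n + 1 : ℕ) : ℤ) by push_cast; ring, zpow_neg, zpow_natCast]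
    have h3 : ε ^ (-((n : ℝ) + 1)) = (ε ^ (n + 1))⁻¹ := by
      rw [Real.rpow_neg hε.le]; norm_cast
    rw [h1, integral_zpow (Or.inr ⟨by omega, h0⟩), h2, h2, h3]
    have h4 : (-((n : ℂ) + 2) + 1) = -((n : ℂ) + 1) := by ring
    push_cast
    rw [h4]
    field_simp
    ring

end HasFinitePart

/-! ### Calculus of principal values over a finite interval -/

namespace HasPVIntegral

variable {h g : ℝ → ℂ} {b c : ℝ} {L M : ℂ}

theorem congr (hc : 0 < c) (hcb : c < b) (hL : HasPVIntegral h c b L)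
    (hhg : ∀ x, 0 ≤ x → x ≠ c → h x = g x) : HasPVIntegral g c b L := by
  obtain ⟨hi, hL⟩ := hL
  have hev : ∀ᶠ ε : ℝ in 𝓝[>] 0, ε ∈ Set.Ioo 0 (min c (b - c)) :=
    Ioo_mem_nhdsGT (lt_min hc (sub_pos.2 hcb))
  have heq1 : ∀ ε ∈ Set.Ioo 0 (min c (b - c)), ∀ x ∈ Set.uIcc 0 (c - ε), h x = g x := by
    rintro ε ⟨h0, h1⟩ x hx
    have h2 := h1.trans_le (min_le_left _ _)
    rw [Set.uIcc_of_le (by linarith)] at hx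
    exact hhg x hx.1 (by linarith [hx.2] : x < c).ne
  have heq2 : ∀ ε ∈ Set.Ioo 0 (min c (b - c)), ∀ x ∈ Set.uIcc (c + ε) b, h x = g x := by
    rintro ε ⟨h0, h1⟩ x hx
    have h2 := h1.trans_le (min_le_right _ _)
    rw [Set.uIcc_of_le (by linarith)] at hx
    exact hhg x (by linarith [hx.1]) (by linarith [hx.1] : c < x).ne'
  refine ⟨?_, hL.congr' ?_⟩
  · filter_upwards [hi, hev] with ε h1 hε
    exact ⟨h1.1.congr fun x hx => heq1 ε hε x (Set.uIoc_subset_uIcc hx),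
      h1.2.congr fun x hx => heq2 ε hε x (Set.uIoc_subset_uIcc hx)⟩
  · filter_upwards [hev] with ε hε
    rw [intervalIntegral.integral_congr (heq1 ε hε), intervalIntegral.integral_congr (heq2 ε hε)]

theorem add (hL : HasPVIntegral h c b L) (hM : HasPVIntegral g c b M) :
    HasPVIntegral (fun x => h x + g x) c b (L + M) := by
  obtain ⟨hi, hL⟩ := hL
  obtain ⟨gi, hM⟩ := hM
  refine ⟨?_, (hL.add hM).congr' ?_⟩
  · filter_upwards [hi, gi] with ε h1 h2 using ⟨h1.1.add h2.1, h1.2.add h2.2⟩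
  · filter_upwards [hi, gi] with ε h1 h2
    rw [intervalIntegral.integral_add h1.1 h2.1, intervalIntegral.integral_add h1.2 h2.2]
    ring

theorem const_mul (hL : HasPVIntegral h c b L) (z : ℂ) :
    HasPVIntegral (fun x => z * h x) c b (z * L) := by
  obtain ⟨hi, hL⟩ := hL
  refine ⟨?_, (hL.const_mul z).congr fun ε => ?_⟩
  · filter_upwards [hi] with ε h1 using ⟨h1.1.const_mul z, h1.2.const_mul z⟩
  · rw [intervalIntegral.integral_const_mul, intervalIntegral.integral_const_mul, mul_add]

theorem add_integral {R : ℝ} (hL : HasPVIntegral h c R L)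
    (hh : IntervalIntegrable h volume R b) : HasPVIntegral h c b (L + ∫ x in R..b, h x) := by
  obtain ⟨hi, hL⟩ := hL
  refine ⟨hi.mono fun ε h1 => ⟨h1.1, h1.2.trans hh⟩, (hL.add_const _).congr' ?_⟩
  filter_upwards [hi] with ε h1
  rw [← intervalIntegral.integral_add_adjacent_intervals h1.2 hh]
  ring

theorem unique {b : ℝ} (hL : HasPVIntegral h c b L) (hM : HasPVIntegral h c b M) : L = M :=
  tendsto_nhds_unique hL.2 hM.2

theorem of_intervalIntegrable (hc : 0 < c) (hcb : c < b)
    (hh : IntervalIntegrable h volume 0 b) :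
    HasPVIntegral h c b (∫ x in (0 : ℝ)..b, h x) := by
  have hb : 0 < b := hc.trans hcb
  have hev : ∀ᶠ ε : ℝ in 𝓝[>] 0, ε ∈ Set.Ioo 0 (min c (b - c)) :=
    Ioo_mem_nhdsGT (lt_min hc (sub_pos.2 hcb))
  have hsub : ∀ x y, 0 ≤ x → x ≤ b → 0 ≤ y → y ≤ b → IntervalIntegrable h volume x y := by
    intro x y h1 h2 h3 h4
    refine hh.mono_set (Set.uIcc_subset_uIcc ?_ ?_) <;> rw [Set.uIcc_of_le hb.le] <;>
      constructor <;> assumption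
  have hm : ∀ ε ∈ Set.Ioo 0 (min c (b - c)), 0 ≤ c - ε ∧ c - ε ≤ b ∧ 0 ≤ c + ε ∧ c + ε ≤ b := by
    rintro ε ⟨h0, h1⟩
    have h2 := h1.trans_le (min_le_right _ _)
    have h3 := h1.trans_le (min_le_left _ _)
    refine ⟨?_, ?_, ?_, ?_⟩ <;> linarith
  refine ⟨hev.mono fun ε hε => ?_, ?_⟩
  · obtain ⟨h1, h2, h3, h4⟩ := hm ε hε
    exact ⟨hsub _ _ le_rfl hb.le h1 h2, hsub _ _ h3 h4 hb.le le_rfl⟩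
  have hcont : ContinuousAt (fun t => ∫ x in (0 : ℝ)..t, h x) c :=
    (intervalIntegral.continuousOn_primitive_interval' hh Set.left_mem_uIcc).continuousAt
      (by rw [Set.uIcc_of_le hb.le]; exact Icc_mem_nhds hc hcb)
  have h1 : Tendsto (fun ε : ℝ => c - ε) (𝓝[>] 0) (𝓝 c) := by
    have : Continuous fun ε : ℝ => c - ε := by fun_prop
    exact (this.tendsto' 0 c (by simp)).mono_left nhdsWithin_le_nhds
  have h2 : Tendsto (fun ε : ℝ => c + ε) (𝓝[>] 0) (𝓝 c) := by
    have : Continuous fun ε : ℝ => c + ε := by fun_prop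
    exact (this.tendsto' 0 c (by simp)).mono_left nhdsWithin_le_nhds
  -- The cut integral is `Φ(c - ε) + Φ(b) - Φ(c + ε)` for the primitive `Φ` from `0`, which is
  -- continuous at `c`.
  have h3 := ((hcont.tendsto.comp h1).add_const (∫ x in (0 : ℝ)..b, h x)).sub
    (hcont.tendsto.comp h2)
  rw [add_sub_cancel_left] at h3
  refine h3.congr' (hev.mono fun ε hε => ?_)
  obtain ⟨k1, k2, k3, k4⟩ := hm ε hε
  rw [← intervalIntegral.integral_add_adjacent_intervals (hsub 0 (c + ε) le_rfl hb.le k3 k4)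
    (hsub (c + ε) b k3 k4 hb.le le_rfl)]
  simp only [Function.comp_apply]
  ring

end HasPVIntegral

/-! ### Size of the finite parts of `f x / x ^ n` -/

/-- The finite parts of `x ^ (-n)` over `(0, R)` are `O(R ^ (-n))`. -/
theorem exists_hasFinitePart_inv_pow_bound {R : ℝ} (hR : 0 < R) :
    ∃ K : ℝ, 0 ≤ K ∧ ∀ n : ℕ, 0 < n → ∃ L : ℂ,
      HasFinitePart (fun x : ℝ => ((x : ℂ) ^ n)⁻¹) R L ∧ ‖L‖ ≤ K / R ^ n := by
  -- The summand `|ln R|` is needed for `n = 1`, the summand `1` for `n ≥ 2`.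
  refine ⟨R * (1 + |Real.log R|), by positivity, fun n hn => ?_⟩
  obtain _ | _ | n := n
  · exact absurd hn (lt_irrefl _)
  · refine ⟨_, (HasFinitePart.inv hR).congr hR fun x _ _ => by simp, ?_⟩
    rw [zero_add, pow_one, mul_div_cancel_left₀ _ hR.ne', Complex.norm_real, Real.norm_eq_abs]
    linarith
  · refine ⟨_, HasFinitePart.inv_pow hR n, ?_⟩
    have h1 : ‖(n : ℂ) + 1‖ = n + 1 := by
      have : ((n : ℂ) + 1) = ((n + 1 : ℝ) : ℂ) := by push_cast; rfl
      rw [this, Complex.norm_real, Real.norm_of_nonneg (by positivity)]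
    rw [norm_neg, norm_inv, norm_mul, h1, norm_pow, Complex.norm_real, Real.norm_of_nonneg hR.le,
      show n + 1 + 1 = (n + 1) + 1 from rfl, pow_succ R (n + 1), mul_comm (R ^ (n + 1)) R,
      mul_div_mul_left _ _ hR.ne', ← one_div]
    have h2 : (1 : ℝ) ≤ n + 1 := by linarith [n.cast_nonneg (α := ℝ)]
    refine div_le_div₀ (by positivity) (by linarith [abs_nonneg (Real.log R)]) (by positivity) ?_
    exact le_mul_of_one_le_left (by positivity) h2

/-- The finite parts of `f x / x ^ n` over `(0, R)` exist and are `O(R ^ (-n))` if `f` is the sum of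
a power series converging absolutely at `R`. -/
theorem exists_hasFinitePart_div_pow_bound_of_hasSum {f : ℝ → ℂ} {c : ℕ → ℂ} {R : ℝ} (hR : 0 < R)
    (hc : Summable fun n => ‖c n‖ * R ^ n)
    (hf : ∀ x : ℝ, 0 ≤ x → x ≤ R → HasSum (fun n => c n * (x : ℂ) ^ n) (f x)) :
    ∃ C : ℝ, 0 ≤ C ∧ ∀ n : ℕ, ∃ L : ℂ,
      HasFinitePart (fun x : ℝ => f x / (x : ℂ) ^ n) R L ∧ ‖L‖ ≤ C / R ^ n := by
  obtain ⟨K, hK, hpow⟩ := exists_hasFinitePart_inv_pow_bound hR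
  set M := ∑' n, ‖c n‖ * R ^ n with hM
  have hM0 : 0 ≤ M := tsum_nonneg fun n => by positivity
  -- Dividing the series by `x ^ n` leaves `n` negative powers, which contribute `M * K`, and a
  -- continuous remainder `r`, bounded by `M / R ^ n` on an interval of length `R`.
  refine ⟨M * K + M * R, by positivity, fun n => ?_⟩
  set r : ℝ → ℂ := fun x => ∑' j, c (j + n) * (x : ℂ) ^ j with hr
  have hsum : Summable fun j => ‖c (j + n)‖ * R ^ j := by
    have := ((summable_nat_add_iff n).2 hc).div_const (R ^ n)
    refine this.congr fun j => ?_
    rw [pow_add]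
    field_simp
  have hbd : ∀ (j : ℕ) (x : ℝ), x ∈ Set.Icc 0 R →
      ‖c (j + n) * (x : ℂ) ^ j‖ ≤ ‖c (j + n)‖ * R ^ j := by
    intro j x hx
    rw [norm_mul, norm_pow, Complex.norm_real, Real.norm_of_nonneg hx.1]
    exact mul_le_mul_of_nonneg_left (pow_le_pow_left₀ hx.1 hx.2 j) (norm_nonneg _)
  have hrc : ContinuousOn r (Set.Icc 0 R) :=
    continuousOn_tsum (fun j => by fun_prop) hsum hbd
  have hrb : ∀ x ∈ Set.Icc 0 R, ‖r x‖ ≤ M / R ^ n := by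
    intro x hx
    refine (tsum_of_norm_bounded hsum.hasSum fun j => hbd j x hx).trans ?_
    rw [le_div_iff₀ (by positivity), ← tsum_mul_right]
    have : (fun j => ‖c (j + n)‖ * R ^ j * R ^ n) = fun j => ‖c (j + n)‖ * R ^ (j + n) := by
      funext j; rw [pow_add]; ring
    rw [this, hM, ← hc.sum_add_tsum_nat_add n]
    exact le_add_of_nonneg_left (Finset.sum_nonneg fun j _ => by positivity)
  have hri : IntervalIntegrable r volume 0 R :=
    ContinuousOn.intervalIntegrable (by rwa [Set.uIcc_of_le hR.le])
  have hchoose : ∀ j : ℕ, ∃ L : ℂ, j < n →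
      HasFinitePart (fun x : ℝ => ((x : ℂ) ^ (n - j))⁻¹) R L ∧ ‖L‖ ≤ K / R ^ (n - j) := fun j => by
    by_cases hj : j < n
    · obtain ⟨L, hL⟩ := hpow (n - j) (Nat.sub_pos_of_lt hj)
      exact ⟨L, fun _ => hL⟩
    · exact ⟨0, fun h => absurd h hj⟩
  choose W hW using hchoose
  have h1 : HasFinitePart (fun x : ℝ => ∑ j ∈ Finset.range n, c j * ((x : ℂ) ^ (n - j))⁻¹) R
      (∑ j ∈ Finset.range n, c j * W j) :=
    HasFinitePart.sum fun j hj => (hW j (Finset.mem_range.1 hj)).1.const_mul (c j)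
  have h2 := HasFinitePart.of_intervalIntegrable hR hri
  refine ⟨_, (h1.add h2).congr hR fun x hx hxR => ?_, ?_⟩
  · have hx0 : (x : ℂ) ≠ 0 := by exact_mod_cast hx.ne'
    have hfx := hf x hx.le hxR
    have hs2 : Summable fun j => c (j + n) * (x : ℂ) ^ j :=
      Summable.of_norm_bounded hsum fun j => hbd j x ⟨hx.le, hxR⟩
    rw [← hfx.tsum_eq, ← hfx.summable.sum_add_tsum_nat_add n, add_div, Finset.sum_div]
    congr 1
    · refine Finset.sum_congr rfl fun j hj => ?_
      rw [← Nat.sub_add_cancel (Finset.mem_range.1 hj).le, pow_add,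
        Nat.sub_add_cancel (Finset.mem_range.1 hj).le]
      field_simp
    · rw [hr, ← tsum_div_const]
      refine tsum_congr fun j => ?_
      rw [pow_add]
      field_simp
  · have h3 : ‖∑ j ∈ Finset.range n, c j * W j‖ ≤ M * K / R ^ n := by
      calc ‖∑ j ∈ Finset.range n, c j * W j‖
          ≤ ∑ j ∈ Finset.range n, ‖c j‖ * R ^ j * (K / R ^ n) := by
            refine norm_sum_le_of_le _ fun j hj => ?_
            have hj := Finset.mem_range.1 hj
            rw [norm_mul, mul_assoc]
            refine mul_le_mul_of_nonneg_left ((hW j hj).2.trans_eq ?_) (norm_nonneg _)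
            have : R ^ n = R ^ (n - j) * R ^ j := by rw [← pow_add, Nat.sub_add_cancel hj.le]
            rw [this]
            field_simp
        _ = (∑ j ∈ Finset.range n, ‖c j‖ * R ^ j) * (K / R ^ n) := by rw [Finset.sum_mul]
        _ ≤ M * (K / R ^ n) := by
            refine mul_le_mul_of_nonneg_right ?_ (by positivity)
            exact hc.sum_le_tsum _ fun j _ => by positivity
        _ = M * K / R ^ n := by ring
    have h4 : ‖∫ x in (0 : ℝ)..R, r x‖ ≤ M * R / R ^ n := by
      have := intervalIntegral.norm_integral_le_of_norm_le_const (a := (0 : ℝ)) (b := R) (f := r)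
        (C := M / R ^ n) fun x hx => by
          rw [Set.uIoc_of_le hR.le] at hx
          exact hrb x ⟨hx.1.le, hx.2⟩
      rw [sub_zero, abs_of_pos hR] at this
      exact this.trans_eq (by ring)
    exact (norm_add_le_of_le h3 h4).trans_eq (by ring)

/-- On `(0, R)` the Taylor series converges absolutely up to `R < ρ`; on `[R, b]` the integrand is
at most `sup |f| / R ^ n`. With `R > ω` the rate `R ^ (-n)` beats the powers of `ω`. -/
theorem exists_hasFinitePart_div_pow_bound {f : ℂ → ℂ} {R ρ : ℝ} (hR : 0 < R) (hRρ : R < ρ)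
    (hf : DifferentiableOn ℂ f (Metric.ball 0 ρ)) {b : ℝ} (hRb : R ≤ b)
    (hfc : ∀ x : ℝ, R ≤ x → x ≤ b → ContinuousAt f x) :
    ∃ C : ℝ, 0 ≤ C ∧ ∀ n : ℕ, ∃ L : ℂ,
      HasFinitePart (fun x : ℝ => f x / (x : ℂ) ^ n) b L ∧ ‖L‖ ≤ C / R ^ n := by
  have hsum : ∀ x : ℝ, 0 ≤ x → x ≤ R →
      HasSum (fun n : ℕ => ((n.factorial : ℂ)⁻¹ * iteratedDeriv n f 0) * (x : ℂ) ^ n) (f x) := by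
    intro x hx hxR
    have hz : (x : ℂ) ∈ Metric.ball (0 : ℂ) ρ := by
      rw [mem_ball_zero_iff, Complex.norm_real, Real.norm_of_nonneg hx]
      linarith
    have := Complex.hasSum_taylorSeries_on_ball hf hz
    refine this.congr_fun fun n => ?_
    simp only [sub_zero, smul_eq_mul]
    ring
  have hcs : Summable fun n : ℕ => ‖(n.factorial : ℂ)⁻¹ * iteratedDeriv n f 0‖ * R ^ n := by
    refine (hsum R hR.le le_rfl).summable.norm.congr fun n => ?_
    rw [norm_mul _ ((R : ℂ) ^ n), norm_pow, Complex.norm_real, Real.norm_of_nonneg hR.le]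
  obtain ⟨C, hC, hFP⟩ := exists_hasFinitePart_div_pow_bound_of_hasSum hR hcs hsum
  have hcont : ContinuousOn (fun x : ℝ => f x) (Set.Icc R b) := fun x hx =>
    ((hfc x hx.1 hx.2).comp Complex.continuous_ofReal.continuousAt).continuousWithinAt
  obtain ⟨B, hB⟩ := isCompact_Icc.exists_bound_of_continuousOn hcont
  have hB0 : 0 ≤ B := (norm_nonneg _).trans (hB R ⟨le_rfl, hRb⟩)
  refine ⟨C + B * (b - R), add_nonneg hC (mul_nonneg hB0 (by linarith)), fun n => ?_⟩
  obtain ⟨L, hL, hLb⟩ := hFP n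
  have hi : IntervalIntegrable (fun x : ℝ => f x / (x : ℂ) ^ n) volume R b := by
    refine ContinuousOn.intervalIntegrable ?_
    rw [Set.uIcc_of_le hRb]
    refine hcont.div (by fun_prop) fun x hx => pow_ne_zero _ ?_
    exact_mod_cast (hR.trans_le hx.1).ne'
  refine ⟨_, hL.add_integral hi, ?_⟩
  have h1 := intervalIntegral.norm_integral_le_of_norm_le_const (a := R) (b := b)
    (f := fun x : ℝ => f x / (x : ℂ) ^ n) (C := B / R ^ n) fun x hx => by
      rw [Set.uIoc_of_le hRb] at hx
      rw [norm_div, norm_pow, Complex.norm_real, Real.norm_of_nonneg (hR.trans hx.1).le]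
      exact div_le_div₀ hB0 (hB x ⟨hx.1.le, hx.2⟩) (by positivity)
        (pow_le_pow_left₀ hR.le hx.1.le n)
  rw [abs_of_nonneg (by linarith)] at h1
  exact (norm_add_le_of_le hLb h1).trans_eq (by ring)

/-! ### The expansion over a finite interval -/

/-- The expansion of the principal value over `(0, a)`, with the extra term `Λ`. -/
def HasPVExpansion (f : ℝ → ℂ) (ω : ℝ) (a : WithTop ℝ) (Λ : ℂ) : Prop :=
  ∃ (I : ℕ → ℂ) (S : ℂ),
    (∀ k : ℕ, HasFinitePart (fun x : ℝ => f x / (x : ℂ) ^ (2 * k + 2)) a (I k)) ∧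
    HasSum (fun k : ℕ => (ω : ℂ) ^ (2 * k + 1) * I k) S ∧
    HasPVIntegral (fun x : ℝ => (ω : ℂ) * f x / ((ω : ℂ) ^ 2 - (x : ℂ) ^ 2)) ω a (-S + Λ)

namespace HasPVExpansion

variable {f g : ℝ → ℂ} {ω b : ℝ} {Λ Λ' : ℂ}

theorem congr (hω : 0 < ω) (hωb : ω < b) (hf : HasPVExpansion f ω b Λ)
    (hfg : ∀ x, 0 ≤ x → f x = g x) : HasPVExpansion g ω b Λ := by
  obtain ⟨I, S, hI, hS, hP⟩ := hf
  exact ⟨I, S, fun k => (hI k).congr (hω.trans hωb) fun x hx _ => by rw [hfg x hx.le], hS,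
    hP.congr hω hωb fun x hx _ => by rw [hfg x hx]⟩

theorem add (hω : 0 < ω) (hωb : ω < b) (hf : HasPVExpansion f ω b Λ)
    (hg : HasPVExpansion g ω b Λ') : HasPVExpansion (fun x => f x + g x) ω b (Λ + Λ') := by
  obtain ⟨I, S, hI, hS, hP⟩ := hf
  obtain ⟨J, T, hJ, hT, hQ⟩ := hg
  refine ⟨fun k => I k + J k, S + T, fun k => ?_, ?_, ?_⟩
  · exact ((hI k).add (hJ k)).congr (hω.trans hωb) fun x _ _ => by rw [add_div]
  · simpa only [mul_add] using hS.add hT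
  · have := (hP.add hQ).congr hω hωb
      (g := fun x : ℝ => (ω : ℂ) * (f x + g x) / ((ω : ℂ) ^ 2 - (x : ℂ) ^ 2))
      fun x _ _ => by rw [mul_add, add_div]
    rwa [show -S + Λ + (-T + Λ') = -(S + T) + (Λ + Λ') by ring] at this

theorem const_mul (hω : 0 < ω) (hωb : ω < b) (hf : HasPVExpansion f ω b Λ) (z : ℂ) :
    HasPVExpansion (fun x => z * f x) ω b (z * Λ) := by
  obtain ⟨I, S, hI, hS, hP⟩ := hf
  refine ⟨fun k => z * I k, z * S, fun k => ?_, ?_, ?_⟩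
  · exact ((hI k).const_mul z).congr (hω.trans hωb) fun x _ _ => by rw [mul_div_assoc]
  · simpa only [mul_left_comm] using hS.mul_left z
  · have := (hP.const_mul z).congr hω hωb
      (g := fun x : ℝ => (ω : ℂ) * (z * f x) / ((ω : ℂ) ^ 2 - (x : ℂ) ^ 2))
      fun x _ _ => by ring
    rwa [show z * (-S + Λ) = -(z * S) + z * Λ by ring] at this

end HasPVExpansion

/-- Principal values by means of an antiderivative on both sides of the singularity. -/
theorem HasPVIntegral.of_hasDerivAt {F g : ℝ → ℝ} {c b ℓ : ℝ} (hc : 0 < c) (hcb : c < b)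
    (hF : ∀ x, 0 ≤ x → x ≠ c → HasDerivAt F (g x) x)
    (hg : ∀ x, 0 ≤ x → x ≠ c → ContinuousAt g x)
    (hℓ : Tendsto (fun ε => F (c - ε) - F (c + ε)) (𝓝[>] 0) (𝓝 ℓ)) :
    HasPVIntegral (fun x => (g x : ℂ)) c b ((F b - F 0 + ℓ : ℝ) : ℂ) := by
  have hev : ∀ᶠ ε : ℝ in 𝓝[>] 0, ε ∈ Set.Ioo 0 (min c (b - c)) :=
    Ioo_mem_nhdsGT (lt_min hc (sub_pos.2 hcb))
  have hx1 : ∀ ε ∈ Set.Ioo 0 (min c (b - c)), ∀ x ∈ Set.uIcc 0 (c - ε), 0 ≤ x ∧ x ≠ c := by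
    rintro ε ⟨h0, h1⟩ x hx
    have h2 := h1.trans_le (min_le_left _ _)
    rw [Set.uIcc_of_le (by linarith)] at hx
    exact ⟨hx.1, (by linarith [hx.2] : x < c).ne⟩
  have hx2 : ∀ ε ∈ Set.Ioo 0 (min c (b - c)), ∀ x ∈ Set.uIcc (c + ε) b, 0 ≤ x ∧ x ≠ c := by
    rintro ε ⟨h0, h1⟩ x hx
    have h2 := h1.trans_le (min_le_right _ _)
    rw [Set.uIcc_of_le (by linarith)] at hx
    exact ⟨by linarith [hx.1], (by linarith [hx.1] : c < x).ne'⟩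
  have hi : ∀ u v : ℝ, (∀ x ∈ Set.uIcc u v, 0 ≤ x ∧ x ≠ c) → IntervalIntegrable g volume u v :=
    fun u v h => ContinuousOn.intervalIntegrable fun x hx =>
      (hg x (h x hx).1 (h x hx).2).continuousWithinAt
  have hFTC : ∀ u v : ℝ, (∀ x ∈ Set.uIcc u v, 0 ≤ x ∧ x ≠ c) →
      ∫ x in u..v, (g x : ℂ) = ((F v - F u : ℝ) : ℂ) := fun u v h => by
    rw [intervalIntegral.integral_ofReal, intervalIntegral.integral_eq_sub_of_hasDerivAt
      (fun x hx => hF x (h x hx).1 (h x hx).2) (hi u v h)]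
  have hiC : ∀ u v : ℝ, (∀ x ∈ Set.uIcc u v, 0 ≤ x ∧ x ≠ c) →
      IntervalIntegrable (fun x => (g x : ℂ)) volume u v :=
    fun u v h => ⟨(hi u v h).1.ofReal, (hi u v h).2.ofReal⟩
  refine ⟨hev.mono fun ε hε => ⟨hiC _ _ (hx1 ε hε), hiC _ _ (hx2 ε hε)⟩, ?_⟩
  have := (Complex.continuous_ofReal.tendsto _).comp (hℓ.const_add (F b - F 0))
  refine this.congr' (hev.mono fun ε hε => ?_)
  beta_reduce
  rw [hFTC _ _ (hx1 ε hε), hFTC _ _ (hx2 ε hε), ← Complex.ofReal_add, Function.comp_apply]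
  congr 1
  ring

/-- Symmetric cutting makes `ln ε` cancel between the two sides of the singularity; this difference
is what is left, both for `1` and for `x`. -/
theorem tendsto_log_sub_log_add {c : ℝ} (hc : 0 < c) :
    Tendsto (fun ε : ℝ => Real.log (2 * c - ε) - Real.log (2 * c + ε)) (𝓝[>] 0) (𝓝 0) := by
  have h : ContinuousAt (fun ε : ℝ => Real.log (2 * c - ε) - Real.log (2 * c + ε)) 0 := by
    refine ContinuousAt.sub (ContinuousAt.log (by fun_prop) ?_) (ContinuousAt.log (by fun_prop) ?_)
      <;> simp [hc.ne']
  have := h.tendsto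
  simp only [sub_zero, add_zero, sub_self] at this
  exact this.mono_left nhdsWithin_le_nhds

theorem sq_sub_sq_ne_zero_of_nonneg {ω x : ℝ} (hω : 0 < ω) (hx : 0 ≤ x) (hxω : x ≠ ω) :
    ω ^ 2 - x ^ 2 ≠ 0 := by
  rw [sq_sub_sq]
  exact mul_ne_zero (by positivity) (sub_ne_zero.2 hxω.symm)

/-! ### The expansion for `1`, `x` and multiples of `ω² - x²` -/

namespace HasPVExpansion

/-- Both sides are `artanh (ω / b)`. -/
theorem one {ω b : ℝ} (hω : 0 < ω) (hωb : ω < b) : HasPVExpansion (fun _ => 1) ω b 0 := by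
  have hb := hω.trans hωb
  have hlt : |ω / b| < 1 := by rw [abs_of_pos (by positivity), div_lt_one hb]; exact hωb
  have hsum := (Real.hasSum_log_sub_log_of_abs_lt_one hlt).mul_left (-(1 / 2))
  refine ⟨fun k => -((((2 * k : ℕ) : ℂ) + 1) * (b : ℂ) ^ (2 * k + 1))⁻¹, _, fun k => ?_,
    (Complex.hasSum_ofReal.2 hsum).congr_fun fun k => ?_, ?_⟩
  · exact (HasFinitePart.inv_pow hb (2 * k)).congr hb fun x _ _ => by rw [one_div]
  · have : (2 * (k : ℂ) + 1) ≠ 0 := by exact_mod_cast (2 * k).succ_ne_zero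
    have : (b : ℂ) ≠ 0 := by exact_mod_cast hb.ne'
    push_cast
    rw [div_pow]
    field_simp
  -- Since `Real.log` is `ln |·|`, one formula is an antiderivative on both sides of `ω`.
  · have key := HasPVIntegral.of_hasDerivAt (F := fun x => (Real.log (ω + x) - Real.log (ω - x)) / 2)
      (g := fun x => ω / (ω ^ 2 - x ^ 2)) (ℓ := 0) hω hωb ?_ ?_ ?_
    · have h1 : Real.log (1 + ω / b) - Real.log (1 - ω / b)
          = Real.log (ω + b) - Real.log (ω - b) := by
        rw [← Real.log_neg_eq_log (ω - b), show 1 + ω / b = (ω + b) / b by field_simp; ring,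
          show 1 - ω / b = -(ω - b) / b by field_simp; ring,
          Real.log_div (by positivity) hb.ne', Real.log_div (by linarith) hb.ne']
        ring
      convert key using 1
      · funext x; push_cast; rw [mul_one]
      · rw [h1]; push_cast; simp; ring
    · intro x hx hxω
      have h1 : ω + x ≠ 0 := by positivity
      have h2 : ω - x ≠ 0 := sub_ne_zero.2 hxω.symm
      have h3 := sq_sub_sq_ne_zero_of_nonneg hω hx hxω
      have := ((((hasDerivAt_id x).const_add ω).log h1).sub
        (((hasDerivAt_id x).const_sub ω).log h2)).div_const 2
      refine this.congr_deriv ?_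
      simp only [id]
      rw [sq_sub_sq]
      field_simp
      ring
    · intro x hx hxω
      exact ContinuousAt.div (by fun_prop) (by fun_prop) (sq_sub_sq_ne_zero_of_nonneg hω hx hxω)
    · have := (tendsto_log_sub_log_add hω).div_const 2
      rw [zero_div] at this
      refine this.congr fun ε => ?_
      rw [show ω - (ω - ε) = ε by ring, show ω - (ω + ε) = -ε by ring, Real.log_neg_eq_log,
        show ω + (ω - ε) = 2 * ω - ε by ring, show ω + (ω + ε) = 2 * ω + ε by ring]
      ring

/-- The principal value is `-(ω/2) ln (b² - ω²) + ω ln ω`, the last term being the antiderivative's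
value at `0`. The series gives the first term: `ω ln b` from `k = 0`, and the series of `ln (1 -
(ω/b)²)` from `k ≥ 1`. -/
theorem id {ω b : ℝ} (hω : 0 < ω) (hωb : ω < b) :
    HasPVExpansion (fun x => (x : ℂ)) ω b (ω * Real.log ω) := by
  have hb := hω.trans hωb
  have hq : 0 < ω / b := by positivity
  have hq1 : ω / b < 1 := by rw [div_lt_one hb]; exact hωb
  have hlt : |(ω / b) ^ 2| < 1 := by
    rw [abs_of_pos (by positivity)]
    exact pow_lt_one₀ hq.le hq1 two_ne_zero
  have hsum := (Real.hasSum_pow_div_log_of_abs_lt_one hlt).mul_left (-(ω / 2))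
  have hbC : (b : ℂ) ≠ 0 := by exact_mod_cast hb.ne'
  -- For `k = 0` the integrand is `1 / x`, hence the separate logarithmic case; index `k + 1` has `x
  -- ^ (-(2k + 3))`.
  set I : ℕ → ℂ := fun k => Nat.casesOn k (Real.log b : ℂ)
    fun k => -((((2 * k + 1 : ℕ) : ℂ) + 1) * (b : ℂ) ^ (2 * k + 1 + 1))⁻¹ with hI
  have hS : HasSum (fun k : ℕ => (ω : ℂ) ^ (2 * k + 1) * I k)
      (((-(ω / 2) * -Real.log (1 - (ω / b) ^ 2) + ω * Real.log b : ℝ)) : ℂ) := by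
    have h2 := (Complex.hasSum_ofReal.2 hsum)
    have h3 : HasSum (fun k : ℕ => (ω : ℂ) ^ (2 * (k + 1) + 1) * I (k + 1)) _ :=
      h2.congr_fun fun k => by
        have : (k : ℂ) + 1 ≠ 0 := by exact_mod_cast k.succ_ne_zero
        have h4 : (2 * (k : ℂ) + 1 + 1) ≠ 0 := by exact_mod_cast (2 * k + 1).succ_ne_zero
        simp only [hI]
        push_cast
        rw [div_pow, div_pow]
        field_simp
        ring
    have := (hasSum_nat_add_iff (f := fun k : ℕ => (ω : ℂ) ^ (2 * k + 1) * I k) 1).1 h3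
    simpa [hI] using this
  refine ⟨I, _, fun k => ?_, hS, ?_⟩
  · cases k with
    | zero =>
      refine (HasFinitePart.inv hb).congr hb fun x hx _ => ?_
      have : (x : ℂ) ≠ 0 := by exact_mod_cast hx.ne'
      field_simp
    | succ k =>
      refine (HasFinitePart.inv_pow hb (2 * k + 1)).congr hb fun x hx _ => ?_
      have : (x : ℂ) ≠ 0 := by exact_mod_cast hx.ne'
      rw [show 2 * (k + 1) + 2 = (2 * k + 1 + 2) + 1 by ring, pow_succ (x : ℂ) (2 * k + 1 + 2)]
      field_simp
  · have key := HasPVIntegral.of_hasDerivAt (F := fun x => -(ω / 2) * Real.log (ω ^ 2 - x ^ 2))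
      (g := fun x => ω * x / (ω ^ 2 - x ^ 2)) (ℓ := 0) hω hωb ?_ ?_ ?_
    · have h1 : Real.log (1 - (ω / b) ^ 2) = Real.log (ω ^ 2 - b ^ 2) - 2 * Real.log b := by
        rw [← Real.log_neg_eq_log (ω ^ 2 - b ^ 2),
          show 1 - (ω / b) ^ 2 = -(ω ^ 2 - b ^ 2) / b ^ 2 by field_simp; ring,
          Real.log_div (by nlinarith) (by positivity), Real.log_pow]
        norm_num
      convert key using 1
      · funext x; push_cast; rfl
      · rw [h1, zero_pow two_ne_zero, sub_zero, Real.log_pow]; push_cast; ring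
    · intro x hx hxω
      have h3 := sq_sub_sq_ne_zero_of_nonneg hω hx hxω
      have := (((hasDerivAt_pow 2 x).const_sub (ω ^ 2)).log h3).const_mul (-(ω / 2))
      refine this.congr_deriv ?_
      field_simp
      norm_num
    · intro x hx hxω
      exact ContinuousAt.div (by fun_prop) (by fun_prop) (sq_sub_sq_ne_zero_of_nonneg hω hx hxω)
    · have := (tendsto_log_sub_log_add hω).const_mul (-(ω / 2))
      rw [mul_zero] at this
      have hev : ∀ᶠ ε : ℝ in 𝓝[>] 0, ε ∈ Set.Ioo 0 ω := Ioo_mem_nhdsGT hω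
      refine this.congr' (hev.mono fun ε hε => ?_)
      beta_reduce
      rw [show ω ^ 2 - (ω - ε) ^ 2 = ε * (2 * ω - ε) by ring,
        show ω ^ 2 - (ω + ε) ^ 2 = -(ε * (2 * ω + ε)) by ring, Real.log_neg_eq_log,
        Real.log_mul hε.1.ne' (by linarith [hε.1, hε.2]),
        Real.log_mul hε.1.ne' (by linarith [hε.1, hε.2])]
      ring

/-- For multiples of `ω ^ 2 - x ^ 2` the expansion telescopes. -/
theorem sq_sub_sq_mul {h : ℂ → ℂ} {ω R ρ b : ℝ} (hω : 0 < ω) (hωR : ω < R) (hRρ : R < ρ)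
    (hRb : R ≤ b) (hh : DifferentiableOn ℂ h (Metric.ball 0 ρ))
    (hhc : ∀ x : ℝ, R ≤ x → x ≤ b → ContinuousAt h x) :
    HasPVExpansion (fun x => ((ω : ℂ) ^ 2 - (x : ℂ) ^ 2) * h x) ω b 0 := by
  have hR := hω.trans hωR
  have hb := hR.trans_le hRb
  obtain ⟨C, hC, hH⟩ := exists_hasFinitePart_div_pow_bound hR hRρ hh hRb hhc
  choose H hH hHb using hH
  have hcont : ContinuousOn (fun x : ℝ => h x) (Set.uIcc 0 b) := fun x hx => by
    rw [Set.uIcc_of_le hb.le] at hx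
    have : ContinuousAt h x := by
      rcases le_or_gt R x with hRx | hxR
      · exact hhc x hRx hx.2
      · refine (hh.differentiableAt (Metric.isOpen_ball.mem_nhds ?_)).continuousAt
        rw [mem_ball_zero_iff, Complex.norm_real, Real.norm_of_nonneg hx.1]
        linarith
    exact (this.comp Complex.continuous_ofReal.continuousAt).continuousWithinAt
  have hint : IntervalIntegrable (fun x : ℝ => h x) volume 0 b := hcont.intervalIntegrable
  have hH0 : H 0 = ∫ x in (0 : ℝ)..b, h x :=
    (hH 0).unique ((HasFinitePart.of_intervalIntegrable hb hint).congr hb fun x _ _ => by simp)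
  -- The `k`-th term of the series is `u (k + 1) - u k`, so the sum is `-u 0`.
  set u : ℕ → ℂ := fun k => (ω : ℂ) ^ (2 * k + 1) * H (2 * k) with hu
  have hq : (ω / R) ^ 2 < 1 :=
    pow_lt_one₀ (by positivity) ((div_lt_one hR).2 hωR) two_ne_zero
  have husum : Summable u := by
    refine Summable.of_norm_bounded
      ((summable_geometric_of_lt_one (by positivity) hq).mul_left (ω * C)) fun k => ?_
    rw [hu, norm_mul, norm_pow, Complex.norm_real, Real.norm_of_nonneg hω.le]
    refine (mul_le_mul_of_nonneg_left (hHb (2 * k)) (by positivity)).trans_eq ?_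
    rw [← pow_mul, div_pow, pow_succ]
    ring
  have hshift := (hasSum_nat_add_iff' 1).2 husum.hasSum
  refine ⟨fun k => (ω : ℂ) ^ 2 * H (2 * k + 2) + (-1) * H (2 * k), -u 0, fun k => ?_, ?_, ?_⟩
  · refine (((hH (2 * k + 2)).const_mul _).add ((hH (2 * k)).const_mul _)).congr hb
      fun x hx _ => ?_
    have : (x : ℂ) ≠ 0 := by exact_mod_cast hx.ne'
    rw [pow_add]
    field_simp
    ring
  · have := hshift.sub husum.hasSum
    rw [Finset.sum_range_one, sub_right_comm, sub_self, zero_sub] at this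
    refine this.congr_fun fun k => ?_
    simp only [hu, Nat.mul_add]
    ring
  · have := (HasPVIntegral.of_intervalIntegrable hω (hωR.trans_le hRb)
      (hint.const_mul (ω : ℂ))).congr hω (hωR.trans_le hRb)
      (g := fun x : ℝ => (ω : ℂ) * (((ω : ℂ) ^ 2 - (x : ℂ) ^ 2) * h x) / ((ω : ℂ) ^ 2 - (x : ℂ) ^ 2))
      fun x hx hxω => by
        have : (ω : ℂ) ^ 2 - (x : ℂ) ^ 2 ≠ 0 := by
          exact_mod_cast sq_sub_sq_ne_zero_of_nonneg hω hx hxω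
        field_simp
    rw [intervalIntegral.integral_const_mul, ← hH0] at this
    simpa [hu] using this

/-- The expansion over a finite interval for a function that is holomorphic in a disc of radius
greater than `ω` and continuous in the rest of the interval. -/
theorem of_differentiableOn {f : ℂ → ℂ} {ω R ρ b : ℝ} (hω : 0 < ω) (hωR : ω < R) (hRρ : R < ρ)
    (hRb : R ≤ b) (hf : DifferentiableOn ℂ f (Metric.ball 0 ρ))
    (hfc : ∀ x : ℝ, R ≤ x → x ≤ b → ContinuousAt f x) :
    HasPVExpansion (fun x => f x) ω b (1 / 2 * (f ω - f (-(ω : ℂ))) * (Real.log ω : ℂ)) := by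
  have hωb := hωR.trans_le hRb
  have hωC : (ω : ℂ) ≠ 0 := by exact_mod_cast hω.ne'
  have hnhds : ∀ z : ℂ, ‖z‖ = ω → Metric.ball (0 : ℂ) ρ ∈ 𝓝 z := fun z hz =>
    Metric.isOpen_ball.mem_nhds (by rw [mem_ball_zero_iff, hz]; linarith)
  -- `f(z) = f(ω) + (z - ω) p(z)` and `p(z) = p(-ω) + (z + ω) q(z)`; `dslope` fills the removable
  -- singularities, so `p` and `q` stay holomorphic in the disc.
  set p : ℂ → ℂ := dslope f ω with hp
  set q : ℂ → ℂ := dslope p (-(ω : ℂ)) with hq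
  have hpd : DifferentiableOn ℂ p (Metric.ball 0 ρ) :=
    (Complex.differentiableOn_dslope (hnhds _ (by simp [hω.le]))).2 hf
  have hqd : DifferentiableOn ℂ q (Metric.ball 0 ρ) :=
    (Complex.differentiableOn_dslope (hnhds _ (by simp [hω.le]))).2 hpd
  have hqc : ∀ x : ℝ, R ≤ x → x ≤ b → ContinuousAt q x := by
    intro x hx hxb
    refine (continuousAt_dslope_of_ne ?_).2 ((continuousAt_dslope_of_ne ?_).2 (hfc x hx hxb))
    · exact_mod_cast (by linarith : -ω < x).ne'
    · exact_mod_cast (by linarith : ω < x).ne'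
  have hpω : p (-(ω : ℂ)) = (f ω - f (-(ω : ℂ))) / (2 * ω) := by
    have := sub_smul_dslope f (ω : ℂ) (-(ω : ℂ))
    rw [smul_eq_mul, ← hp] at this
    field_simp
    linear_combination -this
  have key := ((((one hω hωb).const_mul hω hωb (f ω - ω * p (-(ω : ℂ)))).add hω hωb
    ((id hω hωb).const_mul hω hωb (p (-(ω : ℂ))))).add hω hωb
    ((sq_sub_sq_mul hω hωR hRρ hRb hqd hqc).const_mul hω hωb (-1))).congr hω hωb
    (g := fun x : ℝ => f x) fun x _ => by
      have h1 := sub_smul_dslope f (ω : ℂ) x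
      have h2 := sub_smul_dslope p (-(ω : ℂ)) x
      rw [smul_eq_mul, ← hp] at h1
      rw [smul_eq_mul, ← hq] at h2
      linear_combination h1 + (x - ω : ℂ) * h2
  convert key using 1
  rw [hpω]
  field_simp
  ring

end HasPVExpansion

/-! ### Infinite intervals -/

/-- Abel's test with the multipliers `x ^ (-j)`, with a bound that is uniform in the upper limit. -/
theorem exists_tendsto_integral_div_pow {g : ℝ → ℂ} {r R : ℝ} (hr : 0 ≤ r) (hrR : r < R)
    (hg : ContinuousOn g (Set.Ioi r)) {L : ℂ}
    (hL : Tendsto (fun b => ∫ x in R..b, g x) atTop (𝓝 L)) :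
    ∃ M : ℝ, 0 ≤ M ∧ ∀ j : ℕ,
      (∃ L' : ℂ, Tendsto (fun b => ∫ x in R..b, g x / (x : ℂ) ^ j) atTop (𝓝 L')) ∧
      ∀ b, R ≤ b → ‖∫ x in R..b, g x / (x : ℂ) ^ j‖ ≤ M / R ^ j := by
  have hR : 0 < R := hr.trans_lt hrR
  set G : ℝ → ℂ := fun b => ∫ x in R..b, g x with hG
  have hgi : ∀ u v, r < u → r < v → IntervalIntegrable g volume u v := fun u v hu hv =>
    (hg.mono fun x hx => (lt_min hu hv).trans_le hx.1).intervalIntegrable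
  have hGd : ∀ x, r < x → HasDerivAt G (g x) x := fun x hx =>
    intervalIntegral.integral_hasDerivAt_right (hgi R x hrR hx)
      (hg.stronglyMeasurableAtFilter isOpen_Ioi x hx) (hg.continuousAt (Ioi_mem_nhds hx))
  have hGc : ContinuousOn G (Set.Ioi r) := fun x hx => (hGd x hx).continuousAt.continuousWithinAt
  -- The primitive `G` is continuous and has a limit at infinity.
  obtain ⟨B, hB⟩ : ∃ B : ℝ, ∀ x, R ≤ x → ‖G x‖ ≤ B := by
    obtain ⟨T, hT⟩ := eventually_atTop.1 (hL.norm.eventually_le_const (lt_add_one ‖L‖))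
    obtain ⟨B, hB⟩ := (isCompact_Icc (a := R) (b := T)).exists_bound_of_continuousOn
      (hGc.mono fun x hx => hrR.trans_le hx.1)
    refine ⟨max B (‖L‖ + 1), fun x hx => ?_⟩
    rcases le_total x T with h | h
    · exact (hB x ⟨hx, h⟩).trans (le_max_left _ _)
    · exact (hT x h).trans (le_max_right _ _)
  have hB0 : 0 ≤ B := (norm_nonneg _).trans (hB R le_rfl)
  -- One `B` for the boundary term of the integration by parts, one for the remaining integral.
  refine ⟨2 * B, by positivity, fun j => ?_⟩
  obtain _ | j := j
  · simp only [pow_zero, div_one]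
    exact ⟨⟨L, hL⟩, fun b hb => (hB b hb).trans (by linarith)⟩
  have hrpos : ∀ x, r < x → (x : ℂ) ≠ 0 := fun x hx => by exact_mod_cast (hr.trans_lt hx).ne'
  have hvd : ∀ x : ℝ, r < x →
      HasDerivAt (fun x : ℝ => ((x : ℂ) ^ (j + 1))⁻¹) (-((j + 1 : ℕ) : ℂ) / (x : ℂ) ^ (j + 2)) x := by
    intro x hx
    have h0 := hrpos x hx
    have h1 : HasDerivAt (fun z : ℂ => (z ^ (j + 1))⁻¹) _ (x : ℂ) :=
      (hasDerivAt_pow (j + 1) (x : ℂ)).inv (pow_ne_zero _ h0)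
    refine h1.comp_ofReal.congr_deriv ?_
    rw [Nat.add_sub_cancel]
    field_simp
    ring
  have hgj : ∀ u v, r < u → r < v →
      IntervalIntegrable (fun x => G x / (x : ℂ) ^ (j + 2)) volume u v := fun u v hu hv => by
    refine ContinuousOn.intervalIntegrable (ContinuousOn.div ?_ (by fun_prop) fun x hx =>
      pow_ne_zero _ (hrpos x ((lt_min hu hv).trans_le hx.1)))
    exact hGc.mono fun x hx => (lt_min hu hv).trans_le hx.1
  -- The integral on the right converges absolutely, as `G` is bounded. The factor `j + 1` cancels
  -- against `∫ x ^ (-(j + 2))`, which keeps the bound uniform in `j`.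
  have hparts : ∀ b, R ≤ b → ∫ x in R..b, g x / (x : ℂ) ^ (j + 1)
      = G b / (b : ℂ) ^ (j + 1) + ((j + 1 : ℕ) : ℂ) * ∫ x in R..b, G x / (x : ℂ) ^ (j + 2) := by
    intro b hb
    have hmem : ∀ x ∈ Set.uIcc R b, r < x := fun x hx => by
      rw [Set.uIcc_of_le hb] at hx
      exact hrR.trans_le hx.1
    have h1 : IntervalIntegrable (fun x : ℝ => -((j + 1 : ℕ) : ℂ) / (x : ℂ) ^ (j + 2)) volume R b :=
      ContinuousOn.intervalIntegrable (ContinuousOn.div (by fun_prop) (by fun_prop) fun x hx =>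
        pow_ne_zero _ (hrpos x (hmem x hx)))
    have h2 := intervalIntegral.integral_mul_deriv_eq_deriv_mul
      (fun x hx => hvd x (hmem x hx)) (fun x hx => hGd x (hmem x hx)) h1
      (hgi R b hrR (hrR.trans_le hb))
    have hGR : G R = 0 := intervalIntegral.integral_same
    rw [hGR, mul_zero, sub_zero] at h2
    have h3 : ∫ x in R..b, g x / (x : ℂ) ^ (j + 1) = ∫ x in R..b, ((x : ℂ) ^ (j + 1))⁻¹ * g x :=
      intervalIntegral.integral_congr fun x _ => by ring
    have h4 : ∫ x in R..b, -((j + 1 : ℕ) : ℂ) / (x : ℂ) ^ (j + 2) * G x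
        = -((j + 1 : ℕ) : ℂ) * ∫ x in R..b, G x / (x : ℂ) ^ (j + 2) := by
      rw [← intervalIntegral.integral_const_mul]
      exact intervalIntegral.integral_congr fun x _ => by ring
    rw [h3, h2, h4]
    ring
  have hbound : ∀ x, R ≤ x → ‖G x / (x : ℂ) ^ (j + 2)‖ ≤ B * x ^ (-((j : ℤ) + 2)) := by
    intro x hx
    have hx0 := hR.trans_le hx
    rw [norm_div, norm_pow, Complex.norm_real, Real.norm_of_nonneg hx0.le, zpow_neg, div_eq_mul_inv]
    exact_mod_cast mul_le_mul_of_nonneg_right (hB x hx) (by positivity)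
  constructor
  · have hint : IntegrableOn (fun x : ℝ => G x / (x : ℂ) ^ (j + 2)) (Set.Ioi R) := by
      have h1 : IntegrableOn (fun x : ℝ => B * x ^ (-((j : ℝ) + 2))) (Set.Ioi R) :=
        (integrableOn_Ioi_rpow_of_lt (by linarith [j.cast_nonneg (α := ℝ)]) hR).const_mul B
      refine h1.mono' ?_ ?_
      · refine (ContinuousOn.div (hGc.mono fun x hx => hrR.trans hx) (by fun_prop) fun x hx =>
          pow_ne_zero _ (hrpos x (hrR.trans hx))).aestronglyMeasurable measurableSet_Ioi
      · refine (ae_restrict_mem measurableSet_Ioi).mono fun x hx => (hbound x (le_of_lt hx)).trans_eq ?_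
        rw [← Real.rpow_intCast]
        push_cast
        rfl
    have h2 := intervalIntegral_tendsto_integral_Ioi R hint tendsto_id
    have h3 : Tendsto (fun b : ℝ => ((b : ℂ) ^ (j + 1))⁻¹) atTop (𝓝 0) := by
      have := (Complex.continuous_ofReal.tendsto 0).comp
        (tendsto_inv_atTop_zero.comp (tendsto_pow_atTop (α := ℝ) j.succ_ne_zero))
      rw [Complex.ofReal_zero] at this
      exact this.congr fun b => by simp
    have h4 := (hL.mul h3).add (h2.const_mul ((j + 1 : ℕ) : ℂ))
    refine ⟨_, h4.congr' ?_⟩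
    filter_upwards [eventually_ge_atTop R] with b hb
    rw [hparts b hb, div_eq_mul_inv]
    rfl
  · intro b hb
    have hb0 := hR.trans_le hb
    have h0 : (0 : ℝ) ∉ Set.uIcc R b := fun h => (lt_min hR hb0).not_ge h.1
    have h1 : ‖G b / (b : ℂ) ^ (j + 1)‖ ≤ B / R ^ (j + 1) := by
      rw [norm_div, norm_pow, Complex.norm_real, Real.norm_of_nonneg hb0.le]
      exact div_le_div₀ hB0 (hB b hb) (by positivity) (pow_le_pow_left₀ hR.le hb _)
    have h2 : ‖∫ x in R..b, G x / (x : ℂ) ^ (j + 2)‖ ≤ B / ((j + 1) * R ^ (j + 1)) := by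
      have h3 : IntervalIntegrable (fun x : ℝ => B * x ^ (-((j : ℤ) + 2))) volume R b :=
        (intervalIntegral.intervalIntegrable_zpow (Or.inr h0)).const_mul B
      refine (intervalIntegral.norm_integral_le_of_norm_le hb
        (ae_of_all _ fun x hx => hbound x hx.1.le) h3).trans ?_
      have h4 : ∀ y : ℝ, y ^ (-((j : ℤ) + 2) + 1) = (y ^ (j + 1))⁻¹ := fun y => by
        rw [show -((j : ℤ) + 2) + 1 = -((j + 1 : ℕ) : ℤ) by push_cast; ring, zpow_neg,
          zpow_natCast]
      have h5 : ((-((j : ℤ) + 2) : ℤ) : ℝ) + 1 = -((j : ℝ) + 1) := by push_cast; ring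
      rw [intervalIntegral.integral_const_mul, integral_zpow (Or.inr ⟨by omega, h0⟩), h4, h4, h5,
        div_neg, ← neg_div, neg_sub, div_eq_mul_inv B, mul_inv, mul_comm _ (R ^ (j + 1))⁻¹,
        div_eq_mul_inv _ ((j : ℝ) + 1)]
      refine mul_le_mul_of_nonneg_left (mul_le_mul_of_nonneg_right ?_ (by positivity)) hB0
      exact sub_le_self _ (by positivity)
    have h3 : ‖((j + 1 : ℕ) : ℂ) * ∫ x in R..b, G x / (x : ℂ) ^ (j + 2)‖ ≤ B / R ^ (j + 1) := by
      rw [norm_mul, Complex.norm_natCast]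
      refine (mul_le_mul_of_nonneg_left h2 (by positivity)).trans_eq ?_
      push_cast
      field_simp
    rw [hparts b hb]
    exact (norm_add_le_of_le h1 h3).trans_eq (by ring)

/-- If `f x / x ^ 2` is integrable at infinity, then the expansion holds over `(0, ∞)`. -/
theorem HasPVExpansion.top {f : ℂ → ℂ} {ω R ρ : ℝ} (hω : 0 < ω) (hωR : ω < R) (hRρ : R < ρ)
    (hf : DifferentiableOn ℂ f (Metric.ball 0 ρ)) (hfc : ∀ x : ℝ, 0 ≤ x → ContinuousAt f x)
    {L : ℂ} (hL : Tendsto (fun b : ℝ => ∫ x in R..b, f x / (x : ℂ) ^ 2) atTop (𝓝 L)) :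
    HasPVExpansion (fun x => f x) ω ⊤ (1 / 2 * (f ω - f (-(ω : ℂ))) * (Real.log ω : ℂ)) := by
  have hR := hω.trans hωR
  have hexp : ∀ b : ℝ, R ≤ b → HasPVExpansion (fun x => f x) ω b _ := fun b hb =>
    HasPVExpansion.of_differentiableOn hω hωR hRρ hb hf fun x hx _ => hfc x (hR.le.trans hx)
  obtain ⟨I, S, hI, hS, -⟩ := hexp R le_rfl
  have hcont : ContinuousOn (fun x : ℝ => f x) (Set.Ioi 0) := fun x hx =>
    ((hfc x (le_of_lt hx)).comp Complex.continuous_ofReal.continuousAt).continuousWithinAt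
  have hdiv : ∀ j : ℕ, ContinuousOn (fun x : ℝ => f x / (x : ℂ) ^ j) (Set.Ioi 0) := fun j =>
    hcont.div (by fun_prop) fun x hx => pow_ne_zero _ (by exact_mod_cast (ne_of_gt hx))
  obtain ⟨M, hM, hAbel⟩ := exists_tendsto_integral_div_pow le_rfl hR (hdiv 2) hL
  have hpow : ∀ (k : ℕ) (b : ℝ), ∫ x in R..b, f x / (x : ℂ) ^ 2 / (x : ℂ) ^ (2 * k)
      = ∫ x in R..b, f x / (x : ℂ) ^ (2 * k + 2) := fun k b =>
    intervalIntegral.integral_congr fun x _ => by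
      rw [div_div, ← pow_add, add_comm]
  have hlim : ∀ k : ℕ, ∃ L' : ℂ,
      Tendsto (fun b => ∫ x in R..b, f x / (x : ℂ) ^ (2 * k + 2)) atTop (𝓝 L') := fun k => by
    simpa only [hpow] using (hAbel (2 * k)).1
  choose T hT using hlim
  have hTb : ∀ (k : ℕ) (b : ℝ), R ≤ b →
      ‖∫ x in R..b, f x / (x : ℂ) ^ (2 * k + 2)‖ ≤ M / R ^ (2 * k) := fun k b hb => by
    simpa only [hpow] using (hAbel (2 * k)).2 b hb
  have hIb : ∀ (k : ℕ) (b : ℝ), R ≤ b → HasFinitePart (fun x : ℝ => f x / (x : ℂ) ^ (2 * k + 2)) b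
      (I k + ∫ x in R..b, f x / (x : ℂ) ^ (2 * k + 2)) := fun k b hb =>
    (hI k).add_integral ((hdiv _).mono fun x hx => by
      rw [Set.uIcc_of_le hb] at hx
      exact hR.trans_le hx.1).intervalIntegrable
  have hq : (ω / R) ^ 2 < 1 :=
    pow_lt_one₀ (by positivity) ((div_lt_one hR).2 hωR) two_ne_zero
  -- A majorant independent of `b`: the finite parts over `(0, R)` plus the Abel bound for the
  -- integrals from `R` to `b`.
  have hbsum : Summable fun k : ℕ => ‖(ω : ℂ) ^ (2 * k + 1) * I k‖ + ω * M * ((ω / R) ^ 2) ^ k :=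
    hS.summable.norm.add ((summable_geometric_of_lt_one (by positivity) hq).mul_left _)
  have hb : ∀ (k : ℕ) (z : ℂ), ‖z‖ ≤ M / R ^ (2 * k) →
      ‖(ω : ℂ) ^ (2 * k + 1) * (I k + z)‖
        ≤ ‖(ω : ℂ) ^ (2 * k + 1) * I k‖ + ω * M * ((ω / R) ^ 2) ^ k := by
    intro k z hz
    rw [mul_add]
    refine norm_add_le_of_le le_rfl ?_
    rw [norm_mul, norm_pow, Complex.norm_real, Real.norm_of_nonneg hω.le]
    refine (mul_le_mul_of_nonneg_left hz (by positivity)).trans_eq ?_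
    rw [← pow_mul, div_pow, pow_succ]
    ring
  have hTb' : ∀ k : ℕ, ‖T k‖ ≤ M / R ^ (2 * k) := fun k =>
    le_of_tendsto (hT k).norm ((eventually_ge_atTop R).mono fun b h => hTb k b h)
  have htsum := tendsto_tsum_of_dominated_convergence (𝓕 := atTop)
    (f := fun (b : ℝ) (k : ℕ) => (ω : ℂ) ^ (2 * k + 1) *
      (I k + ∫ x in R..b, f x / (x : ℂ) ^ (2 * k + 2)))
    (g := fun k : ℕ => (ω : ℂ) ^ (2 * k + 1) * (I k + T k)) hbsum
    (fun k => ((hT k).const_add (I k)).const_mul _)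
    ((eventually_ge_atTop R).mono fun b h k => hb k _ (hTb k b h))
  refine ⟨fun k => I k + T k, _, fun k => ⟨_, ?_, (hT k).const_add (I k)⟩,
    (Summable.of_norm_bounded hbsum fun k => hb k _ (hTb' k)).hasSum,
    ⟨_, ?_, htsum.neg.add_const _⟩⟩
  · filter_upwards [eventually_ge_atTop R] with b h using hIb k b h
  · filter_upwards [eventually_ge_atTop R] with b h
    obtain ⟨J, S', hJ, hS', hP⟩ := hexp b h
    -- Uniqueness of finite parts identifies the coefficients supplied by the expansion over `(0,
    -- b)`.
    have : J = fun k => I k + ∫ x in R..b, f x / (x : ℂ) ^ (2 * k + 2) :=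
      funext fun k => (hJ k).unique (hIb k b h)
    rw [← hS'.tsum_eq, this] at hP
    exact hP

/-- If the principal value over `(0, ∞)` exists, then `f x / x ^ 2` is integrable at infinity. -/
theorem HasPVIntegral.exists_tendsto_integral_div_sq {f : ℂ → ℂ} {ω R : ℝ} {L PR : ℂ} (hω : 0 < ω)
    (hωR : ω < R) (hfc : ∀ x : ℝ, 0 ≤ x → ContinuousAt f x)
    (hR : HasPVIntegral (fun x : ℝ => (ω : ℂ) * f x / ((ω : ℂ) ^ 2 - (x : ℂ) ^ 2)) ω R PR)
    (hL : HasPVIntegral (fun x : ℝ => (ω : ℂ) * f x / ((ω : ℂ) ^ 2 - (x : ℂ) ^ 2)) ω ⊤ L) :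
    ∃ L' : ℂ, Tendsto (fun b : ℝ => ∫ x in R..b, f x / (x : ℂ) ^ 2) atTop (𝓝 L') := by
  obtain ⟨P, hP, hPL⟩ := hL
  set g : ℝ → ℂ := fun x => (ω : ℂ) * f x / ((ω : ℂ) ^ 2 - (x : ℂ) ^ 2) with hg
  have hne : ∀ x : ℝ, ω < x → (ω : ℂ) ^ 2 - (x : ℂ) ^ 2 ≠ 0 := fun x hx => by
    exact_mod_cast sq_sub_sq_ne_zero_of_nonneg hω (hω.trans hx).le hx.ne'
  have hgc : ContinuousOn g (Set.Ioi ω) := by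
    refine ContinuousOn.div (ContinuousOn.mul continuousOn_const fun x hx => ?_) (by fun_prop)
      fun x hx => hne x hx
    exact ((hfc x (hω.trans hx).le).comp Complex.continuous_ofReal.continuousAt).continuousWithinAt
  have hgi : ∀ b, R ≤ b → ∀ {h : ℝ → ℂ}, ContinuousOn h (Set.Ioi ω) →
      IntervalIntegrable h volume R b := fun b hb h hh =>
    (hh.mono fun x hx => by
      rw [Set.uIcc_of_le hb] at hx
      exact hωR.trans_le hx.1).intervalIntegrable
  have hG : Tendsto (fun b => ∫ x in R..b, g x) atTop (𝓝 (L - PR)) := by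
    refine (hPL.sub_const PR).congr' ?_
    filter_upwards [hP, eventually_ge_atTop R] with b hPb hb
    rw [HasPVIntegral.unique hPb (hR.add_integral (hgi b hb hgc)), add_sub_cancel_left]
  obtain ⟨M, -, hM⟩ := exists_tendsto_integral_div_pow hω.le hωR hgc hG
  obtain ⟨L2, hL2⟩ := (hM 2).1
  have hg2 : ContinuousOn (fun x : ℝ => g x / (x : ℂ) ^ 2) (Set.Ioi ω) :=
    hgc.div (by fun_prop) fun x hx => pow_ne_zero _ (by exact_mod_cast (hω.trans hx).ne')
  -- `f / x² = ω g / x² - g / ω`, and both integrals on the right converge.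
  refine ⟨_, ((hL2.const_mul (ω : ℂ)).sub (hG.const_mul (ω : ℂ)⁻¹)).congr' ?_⟩
  filter_upwards [eventually_ge_atTop R] with b hb
  rw [← intervalIntegral.integral_const_mul, ← intervalIntegral.integral_const_mul,
    ← intervalIntegral.integral_sub ((hgi b hb hg2).const_mul _) ((hgi b hb hgc).const_mul _)]
  refine intervalIntegral.integral_congr fun x hx => ?_
  rw [Set.uIcc_of_le hb] at hx
  have hωx := hωR.trans_le hx.1
  have h1 := hne x hωx
  have h2 : (x : ℂ) ≠ 0 := by exact_mod_cast (hω.trans hωx).ne'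
  have h3 : (ω : ℂ) ≠ 0 := by exact_mod_cast hω.ne'
  simp only [hg]
  field_simp

/-- A finite part without divergence is an ordinary integral. -/
theorem HasFinitePart.hasIntegralUpTo {h g : ℝ → ℂ} {a : WithTop ℝ} {L : ℂ} (ha : 0 < a)
    (hL : HasFinitePart h a L) (hhg : ∀ x, 0 < x → h x = g x)
    (hg : ∀ b : ℝ, 0 < b → (b : WithTop ℝ) ≤ a → IntervalIntegrable g volume 0 b) :
    HasIntegralUpTo g a L := by
  have key : ∀ (b : ℝ) (L : ℂ), 0 < b → (b : WithTop ℝ) ≤ a → HasFinitePart h b L →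
      HasIntegralUpTo g b L := fun b L hb hba hL =>
    ⟨hg b hb hba, (HasFinitePart.of_intervalIntegrable hb (hg b hb hba)).unique
      (hL.congr hb fun x hx _ => hhg x hx)⟩
  cases a with
  | coe b => exact key b L (by exact_mod_cast ha) le_rfl hL
  | top =>
    obtain ⟨P, hP, hPL⟩ := hL
    refine ⟨P, ?_, hPL⟩
    filter_upwards [hP, eventually_gt_atTop 0] with b hb hb0
    exact key b _ hb0 le_top hb

/-! ### From the analyticity hypotheses to the theorem -/

theorem differentiableOn_ball_of_lt_singularityDist {f : ℂ → ℂ} {ρ : ℝ}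
    (hρ : ENNReal.ofReal ρ < singularityDist f) : DifferentiableOn ℂ f (Metric.ball 0 ρ) := by
  intro z hz
  by_contra hn
  have hz' : ¬ AnalyticAt ℂ f z := fun h => hn h.differentiableAt.differentiableWithinAt
  refine (Metric.infEDist_le_edist_of_mem (x := (0 : ℂ)) hz').not_gt (lt_of_le_of_lt ?_ hρ)
  rw [edist_dist, dist_comm]
  exact ENNReal.ofReal_le_ofReal (le_of_lt hz)

theorem hasPVExpansion_of_complexAnalyticUpTo {f : ℂ → ℂ} {a : WithTop ℝ}
    (hf : ComplexAnalyticUpTo f a) {ω : ℝ} (hω : 0 < ω) (hωa : (ω : WithTop ℝ) < a)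
    (hωρ : ENNReal.ofReal ω < singularityDist f)
    (htop : a = ⊤ →
      (∃ L : ℂ, HasPVIntegral (fun x : ℝ => (ω : ℂ) * f x / ((ω : ℂ) ^ 2 - (x : ℂ) ^ 2)) ω ⊤ L) ∨
      ImproperIntegrableAtInfty (fun x : ℝ => f x / (x : ℂ) ^ 2)) :
    HasPVExpansion (fun x => f x) ω a (1 / 2 * (f ω - f (-(ω : ℂ))) * (Real.log ω : ℂ)) := by
  -- The distance may be infinite, so a finite radius beyond `ω` is taken.
  obtain ⟨ρ, hρ0, hωρ', hρ⟩ := ENNReal.lt_iff_exists_real_btwn.1 hωρ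
  have hωρ : ω < ρ := (ENNReal.ofReal_lt_ofReal_iff_of_nonneg hω.le).1 hωρ'
  have hd := differentiableOn_ball_of_lt_singularityDist hρ
  cases a with
  | coe b =>
    have hωb : ω < b := by exact_mod_cast hωa
    obtain ⟨R, hωR, hR⟩ := exists_between (lt_min hωρ hωb)
    exact HasPVExpansion.of_differentiableOn hω hωR (hR.trans_le (min_le_left _ _))
      (hR.trans_le (min_le_right _ _)).le hd fun x hx hxb =>
        (hf x ((hω.trans hωR).le.trans hx) (by exact_mod_cast hxb)).continuousAt
  | top =>
    obtain ⟨R, hωR, hR⟩ := exists_between hωρ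
    have hfc : ∀ x : ℝ, 0 ≤ x → ContinuousAt f x := fun x hx => (hf x hx le_top).continuousAt
    obtain ⟨L, hL⟩ : ∃ L : ℂ,
        Tendsto (fun b : ℝ => ∫ x in R..b, f x / (x : ℂ) ^ 2) atTop (𝓝 L) := by
      rcases htop rfl with ⟨L, hL⟩ | ⟨L, hL⟩
      · obtain ⟨I, S, -, -, hP⟩ := HasPVExpansion.of_differentiableOn hω hωR hR le_rfl hd
          fun x hx _ => hfc x ((hω.trans hωR).le.trans hx)
        exact hP.exists_tendsto_integral_div_sq hω hωR hfc hL
      · have hi : ∀ u v : ℝ, 0 < u → 0 < v →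
            IntervalIntegrable (fun x : ℝ => f x / (x : ℂ) ^ 2) volume u v := fun u v hu hv => by
          refine ContinuousOn.intervalIntegrable (ContinuousOn.div (fun x hx => ?_) (by fun_prop)
            fun x hx => pow_ne_zero _ ?_)
          · exact ((hfc x ((lt_min hu hv).trans_le hx.1).le).comp
              Complex.continuous_ofReal.continuousAt).continuousWithinAt
          · exact_mod_cast ((lt_min hu hv).trans_le hx.1).ne'
        refine ⟨_, (hL.sub_const (∫ x in (1 : ℝ)..R, f x / (x : ℂ) ^ 2)).congr' ?_⟩
        filter_upwards [eventually_gt_atTop 0] with b hb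
        rw [intervalIntegral.integral_interval_sub_left (hi 1 b one_pos hb)
          (hi 1 R one_pos (hω.trans hωR))]
    exact HasPVExpansion.top hω hωR hR hd hfc hL

theorem theorem5p1 (f : ℂ → ℂ) (a : WithTop ℝ) (hf : ComplexAnalyticUpTo f a)
    (ω : ℝ) (hω : 0 < ω) (hωa : (ω : WithTop ℝ) < a)
    (hωρ : ENNReal.ofReal ω < singularityDist f)
    -- for the infinite interval only: the principal value exists in the limit of infinite upper
    -- end point, or `f(x) / x ^ 2` is integrable at infinity
    (htop : a = ⊤ →
      (∃ L : ℂ, HasPVIntegral (fun x : ℝ => (ω : ℂ) * f x / ((ω : ℂ) ^ 2 - (x : ℂ) ^ 2)) ω ⊤ L) ∨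
      ImproperIntegrableAtInfty (fun x : ℝ => f x / (x : ℂ) ^ 2)) :
    -- the general formula
    (∃ (I : ℕ → ℂ) (S : ℂ),
      (∀ k : ℕ, HasFinitePart (fun x : ℝ => f x / (x : ℂ) ^ (2 * k + 2)) a (I k)) ∧
      HasSum (fun k : ℕ => (ω : ℂ) ^ (2 * k + 1) * I k) S ∧
      HasPVIntegral (fun x : ℝ => (ω : ℂ) * f x / ((ω : ℂ) ^ 2 - (x : ℂ) ^ 2)) ω a
        (-S + 1 / 2 * (f ω - f (-(ω : ℂ))) * (Real.log ω : ℂ))) ∧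
    -- the formula for even `f`
    (EvenWithin f (singularityDist f) →
      ∃ (I : ℕ → ℂ) (S : ℂ),
        (∀ k : ℕ, HasFinitePart (fun x : ℝ => f x / (x : ℂ) ^ (2 * k + 2)) a (I k)) ∧
        HasSum (fun k : ℕ => (ω : ℂ) ^ (2 * k + 1) * I k) S ∧
        HasPVIntegral (fun x : ℝ => (ω : ℂ) * f x / ((ω : ℂ) ^ 2 - (x : ℂ) ^ 2)) ω a (-S)) ∧
    -- the formula for `f(x) = x ^ m g(x)`; here `k < m / 2` means `k ≤ ⌊(m - 2) / 2⌋`, so that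
    -- the exponent `m - 2 * k - 2` is not truncated
    (∀ (m : ℕ) (g : ℂ → ℂ), 0 < m → AnalyticAt ℂ g 0 → (∀ z : ℂ, f z = z ^ m * g z) →
      (∃ (J I : ℕ → ℂ) (S : ℂ),
        (∀ k < m / 2,
          HasIntegralUpTo (fun x : ℝ => (x : ℂ) ^ (m - 2 * k - 2) * g x) a (J k)) ∧
        (∀ k : ℕ, HasFinitePart
          (fun x : ℝ => (x : ℂ) ^ m * g x / (x : ℂ) ^ (2 * k + 2 * (m / 2) + 2)) a (I k)) ∧
        HasSum (fun k : ℕ => (ω : ℂ) ^ (2 * k + 2 * (m / 2) + 1) * I k) S ∧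
        HasPVIntegral (fun x : ℝ => (ω : ℂ) * f x / ((ω : ℂ) ^ 2 - (x : ℂ) ^ 2)) ω a
          (-(∑ k ∈ Finset.range (m / 2), (ω : ℂ) ^ (2 * k + 1) * J k) - S
            + (ω : ℂ) ^ m / 2 * (g ω - (-1) ^ m * g (-(ω : ℂ))) * (Real.log ω : ℂ))) ∧
      -- its third term vanishes for even `g` and even `m`
      (Even m → EvenWithin g (singularityDist f) →
        (ω : ℂ) ^ m / 2 * (g ω - (-1) ^ m * g (-(ω : ℂ))) * (Real.log ω : ℂ) = 0)) := by
  have hωC : (ω : ℂ) ≠ 0 := by exact_mod_cast hω.ne'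
  have ha : (0 : WithTop ℝ) < a := lt_trans (by exact_mod_cast hω) hωa
  obtain ⟨I, S, hI, hS, hP⟩ := hasPVExpansion_of_complexAnalyticUpTo hf hω hωa hωρ htop
  beta_reduce at hI hP
  have heven : ∀ h : ℂ → ℂ, EvenWithin h (singularityDist f) → h (-(ω : ℂ)) = h ω := fun h hh =>
    hh ω (by rwa [abs_of_pos hω])
  refine ⟨⟨I, S, hI, hS, hP⟩, fun hev => ⟨I, S, hI, hS, ?_⟩, fun m g hm hg hfg => ⟨?_, ?_⟩⟩
  · simpa [heven f hev] using hP
  -- The series of the first formula is split at `m / 2`; for `k < m / 2` the integrand has no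
  -- singularity at `0`.
  · refine ⟨I, fun k => I (k + m / 2), S - ∑ k ∈ Finset.range (m / 2), (ω : ℂ) ^ (2 * k + 1) * I k,
      fun k hk => ?_, fun k => ?_, ?_, ?_⟩
    · refine (hI k).hasIntegralUpTo ha (fun x hx => ?_) fun b hb hba => ?_
      · have hx0 : (x : ℂ) ≠ 0 := by exact_mod_cast hx.ne'
        have hmk : m = (m - 2 * k - 2) + (2 * k + 2) := by omega
        rw [hfg, div_eq_iff (pow_ne_zero _ hx0), mul_right_comm, ← pow_add, ← hmk]
      · refine ContinuousOn.intervalIntegrable (ContinuousOn.mul (by fun_prop) fun x hx => ?_)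
        rw [Set.uIcc_of_le hb.le] at hx
        refine ContinuousAt.continuousWithinAt
          (ContinuousAt.comp (g := g) ?_ Complex.continuous_ofReal.continuousAt)
        -- At `0` the analyticity of `g` is needed; elsewhere `g = f / z ^ m` inherits continuity
        -- from `f`.
        rcases hx.1.eq_or_lt with rfl | hx0
        · simpa using hg.continuousAt
        · have hx0 : (x : ℂ) ≠ 0 := by exact_mod_cast hx0.ne'
          have hfx := (hf x hx.1 (le_trans (by exact_mod_cast hx.2) hba)).continuousAt
          refine (hfx.div (continuousAt_id.pow m) (pow_ne_zero m hx0)).congr ?_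
          filter_upwards [isOpen_ne.mem_nhds hx0] with z hz
          rw [Pi.div_apply, hfg]
          exact mul_div_cancel_left₀ _ (pow_ne_zero m hz)
    · have := hI (k + m / 2)
      simp only [hfg] at this
      rwa [Nat.mul_add] at this
    · have := (hasSum_nat_add_iff' (m / 2)).2 hS
      simpa only [Nat.mul_add] using this
    · convert hP using 1
      rw [hfg ω, hfg (-(ω : ℂ)), neg_pow (ω : ℂ) m]
      ring
  · intro hme hge
    simp [hme.neg_one_pow, heven g hge]
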